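/- Let $q=2^r$ with $r\ge 1$, let $c\in\mathbb{F}_q$ and let $m\ge 1$. Let $\mathrm{tr}:\mathbb{F}_{q^m}\to\mathbb{F}_q$ be the relative trace, and let $G_{c,3}(m)$ be the number of $z\in\mathbb{F}_{q^m}$ with $\mathrm{tr}(z)=0$ and $\mathrm{tr}(z^3)=c$ that have degree $m$ over $\mathbb{F}_q$, that is, lie in no intermediate field $\mathbb{F}_{q^n}$, $n<m$, of $\mathbb{F}_{q^m}/\mathbb{F}_q$. Then the number of monic irreducible polynomials $x^m+a_{m-1}x^{m-1}+\dots+a_1x+a_0$ in $\mathbb{F}_q[x]$ with $a_{m-1}=0$ and $a_{m-3}=c$ (where $a_i=0$ for $i<0$) equals $G_{c,3}(m)/m$. Moreover, for $1\le m\le 30$, $G_{c,3}(m)$ has the following values. If $r$ is even and $c=0$ (first column), $r$ is odd and $c=0$ (second column), or $r$ is odd and $c\neq0$ (third column): $$\begin{array}{c|c|c|c} m & 2\mid r,\ c=0 & 2\nmid r,\ c=0 & 2\nmid r,\ c\ne0 \\ \hline 1 & 1 & 1 & 0 \\ 2 & 0 & 0 & 0 \\ 3 & 0 & 0 & q+1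 \\ 4 & 0 & 0 & q^2 \\ 5 & q^3+q^2-q-1 & q^3-q^2+q-1 & q^3+q \\ 6 & q^4-2q^3+q^2 & q^4-q^2 & q^4-q^2 \\ 7 & q^5+q^3-q^2-1 & q^5+q^3-q^2-1 & q^5-q^2 \\ 8 & q^6-q^4 & q^6-3q^4+2q^3 & q^6+2q^3 \\ 9 & q^7-q^4+q^3-1 & q^7+q^4-q^3-1 & q^7-q^3-q-1 \\ 10 & q^8-q^4 & q^8-q^4 & q^8-q^4 \\ 11 & q^9+q^5-q^4-1 & q^9-q^5+q^4-1 & q^9+q^4 \\ 12 & q^{10}-3q^6+2q^5 & q^{10}-q^6 & q^{10}-q^2 \\ 13 & q^{11}+q^6-q^5-1 & q^{11}-q^6+q^5-1 & q^{11}+q^5 \\ 14 & q^{12}-q^6 & q^{12}-q^6 & q^{12}-q^6 \\ 15 & q^{13}-q^7+q^6-q^3-q^2+q & q^{13}+q^7-q^6-q^3+q^2-q & q^{13}-q^6-q^3-2q-1 \\ 16 & q^{14}-q^8 & q^{14}-3q^8+2q^7 & q^{14}+2q^7 \\ 17 & q^{15}+q^8-q^7-1 & q^{15}+q^8-q^7-1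 & q^{15}-q^7 \\ 18 & q^{16}-2q^9+q^8-q^4+2q^3-q^2 & q^{16}-q^8-q^4+q^2 & q^{16}-q^8-q^4+q^2 \\ 19 & q^{17}+q^9-q^8-1 & q^{17}-q^9+q^8-1 & q^{17}+q^8 \\ 20 & q^{18}-q^{10} & q^{18}-q^{10} & q^{18}-q^2 \\ 21 & q^{19}-q^{10}+q^9-q^5-q^3+q^2 & q^{19}-q^{10}+q^9-q^5-q^3+q^2 & q^{19}+q^9-q^5+q^2-q-1 \\ 22 & q^{20}-q^{10} & q^{20}-q^{10} & q^{20}-q^{10} \\ 23 & q^{21}+q^{11}-q^{10}-1 & q^{21}+q^{11}-q^{10}-1 & q^{21}-q^{10} \\ 24 & q^{22}-3q^{12}+2q^{11}-q^6+q^4 & q^{22}-3q^{12}+2q^{11}-q^6+3q^4-2q^3 & q^{22}+2q^{11}-q^6-2q^3 \\ 25 & q^{23}+q^{12}-q^{11}-q^3-q^2+q & q^{23}+q^{12}-q^{11}-q^3+q^2-q & q^{23}-q^{11}-q^3-q \\ 26 & q^{24}-q^{12} & q^{24}-q^{12} & q^{24}-q^{12} \\ 27 & q^{25}-q^{13}+q^{12}-q^7+q^4-q^3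 & q^{25}-q^{13}+q^{12}-q^7-q^4+q^3 & q^{25}+q^{12}-q^7+q^3 \\ 28 & q^{26}-q^{14} & q^{26}-q^{14} & q^{26}-q^2 \\ 29 & q^{27}+q^{14}-q^{13}-1 & q^{27}-q^{14}+q^{13}-1 & q^{27}+q^{13} \\ 30 & q^{28}-2q^{15}+q^{14}-q^8+2q^3-q^2 & q^{28}-q^{14}-q^8+q^2 & q^{28}-q^{14}-q^8+q^2 \end{array}$$ If $r$ is even and $c\ne0$, let $\gamma$ be any primitive element of $\mathbb{F}_q$ (a generator of $\mathbb{F}_q^*$), and put $\varepsilon=(-1)^{r/2}$. Then: $$\begin{array}{c|c|c} m & c\in\langle\gamma^3\rangle & c\notin\langle\gamma^3\rangle \\ \hline 1 & 0 & 0 \\ 2 & 0 & 0 \\ 3 & q-2\varepsilon q^{1/2}+1 & q+\varepsilon q^{1/2}+1 \\ 4 & q^2 +2\varepsilon q^{3/2} & q^2 -\varepsilon q^{3/2} \\ 5 & q^3-q & q^3-q \\ 6 & q^4-2\varepsilon q^{5/2}+q^2 & q^4+\varepsilon q^{5/2}+q^2 \\ 7 & q^5-q^2 & q^5-q^2 \\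 8 & q^6+2\varepsilon q^{7/2} & q^6-\varepsilon q^{7/2} \\ 9 & q^7 -2\varepsilon q^{7/2}+q^3-q+2\varepsilon q^{1/2}-1 & q^7 +\varepsilon q^{7/2}+q^3-q-\varepsilon q^{1/2}-1 \\ 10 & q^8-q^4 & q^8-q^4 \\ 11 & q^9-q^4 & q^9-q^4 \\ 12 & q^{10}+2q^5-q^2-2\varepsilon q^{3/2} & q^{10}+2q^5-q^2+\varepsilon q^{3/2} \\ 13 & q^{11}-q^5 & q^{11}-q^5 \\ 14 & q^{12}-q^6 & q^{12}-q^6 \\ 15 & q^{13}-2\varepsilon q^{13/2}+q^6-q^3+2\varepsilon q^{1/2}-1 & q^{13}+\varepsilon q^{13/2}+q^6-q^3-\varepsilon q^{1/2}-1 \\ 16 & q^{14}+2\varepsilon q^{15/2} & q^{14}-\varepsilon q^{15/2} \\ 17 & q^{15}-q^7 & q^{15}-q^7 \\ 18 & q^{16} -2\varepsilon q^{17/2}+q^8-q^4+2\varepsilon q^{5/2}-q^2 & q^{16} +\varepsilon q^{17/2}+q^8-q^4-\varepsilon q^{5/2}-q^2 \\ 19 & q^{17}-q^8 & q^{17}-q^8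 \\ 20 & q^{18} +2\varepsilon q^{19/2}-q^2 -2\varepsilon q^{3/2} & q^{18} -\varepsilon q^{19/2}-q^2 +\varepsilon q^{3/2} \\ 21 & q^{19}-2\varepsilon q^{19/2}+q^9-q^5+q^2-q+2\varepsilon q^{1/2}-1 & q^{19}+\varepsilon q^{19/2}+q^9-q^5+q^2-q-\varepsilon q^{1/2}-1 \\ 22 & q^{20}-q^{10} & q^{20}-q^{10} \\ 23 & q^{21}-q^{10} & q^{21}-q^{10} \\ 24 & q^{22}+2q^{11}-q^6-2\varepsilon q^{7/2} & q^{22}+2q^{11}-q^6+\varepsilon q^{7/2} \\ 25 & q^{23}-q^{11}-q^3+q & q^{23}-q^{11}-q^3+q \\ 26 & q^{24}-q^{12} & q^{24}-q^{12} \\ 27 & q^{25} -2\varepsilon q^{25/2}+q^{12}-q^7+2\varepsilon q^{7/2}-q^3 & q^{25} +\varepsilon q^{25/2}+q^{12}-q^7-\varepsilon q^{7/2}-q^3 \\ 28 & q^{26}+2\varepsilon q^{27/2}-q^2-2\varepsilon q^{3/2} & q^{26}-\varepsilon q^{27/2}-q^2+\varepsilon q^{3/2} \\ 29 & q^{27}-q^{13}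 & q^{27}-q^{13} \\ 30 & q^{28}-2\varepsilon q^{29/2}+q^{14}-q^8+2\varepsilon q^{5/2}-q^2 & q^{28}+\varepsilon q^{29/2}+q^{14}-q^8-\varepsilon q^{5/2}-q^2 \end{array}$$ -/

import Mathlib

open scoped Polynomial

noncomputable section

/-- For `P = x^m + a_{m-1} x^{m-1} + ⋯ + a_0` of degree `m`, the coefficient `a_{m-k}`,
where `a_i = 0` for `i < 0`. -/
def topCoeff {F : Type*} [Field F] (P : F[X]) (k : ℕ) : F :=
  if k ≤ P.natDegree then P.coeff (P.natDegree - k) else 0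

/-- The number of monic irreducible polynomials of degree `m` over `F` with
`a_{m-1} = 0` and `a_{m-3} = c`. -/
def numIrreducible {F : Type*} [Field F] (c : F) (m : ℕ) : ℕ :=
  {P : F[X] | P.Monic ∧ Irreducible P ∧ P.natDegree = m ∧
    topCoeff P 1 = 0 ∧ topCoeff P 3 = c}.ncard

/-- The number of `z` in the extension `K` of `F` with `Tr z = 0` and `Tr (z ^ d) = c` which lie
in no field between `F` and `K` of degree over `F` smaller than `[K : F]`.
For `F = 𝔽_q` and `K = 𝔽_{q^m}` this is `G_{c,d}(m)`. -/
def countG (F K : Type*) [Field F] [Field K] [Algebra F K] (c : F) (d : ℕ) : ℕ :=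
  {z : K | Algebra.trace F K z = 0 ∧ Algebra.trace F K (z ^ d) = c ∧
    ∀ L : IntermediateField F K,
      Module.finrank F L < Module.finrank F K → z ∉ L}.ncard

/-- `G_{0,3}(m)` for `1 ≤ m ≤ 30`, `q = 2^r`, `r` even. -/
def tableEvenZero (q : ℝ) : ℕ → ℝ
  | 1 => 1
  | 2 => 0
  | 3 => 0
  | 4 => 0
  | 5 => q^3 + q^2 - q - 1
  | 6 => q^4 - 2 * q^3 + q^2
  | 7 => q^5 + q^3 - q^2 - 1
  | 8 => q^6 - q^4
  | 9 => q^7 - q^4 + q^3 - 1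
  | 10 => q^8 - q^4
  | 11 => q^9 + q^5 - q^4 - 1
  | 12 => q^10 - 3 * q^6 + 2 * q^5
  | 13 => q^11 + q^6 - q^5 - 1
  | 14 => q^12 - q^6
  | 15 => q^13 - q^7 + q^6 - q^3 - q^2 + q
  | 16 => q^14 - q^8
  | 17 => q^15 + q^8 - q^7 - 1
  | 18 => q^16 - 2 * q^9 + q^8 - q^4 + 2 * q^3 - q^2
  | 19 => q^17 + q^9 - q^8 - 1
  | 20 => q^18 - q^10
  | 21 => q^19 - q^10 + q^9 - q^5 - q^3 + q^2
  | 22 => q^20 - q^10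
  | 23 => q^21 + q^11 - q^10 - 1
  | 24 => q^22 - 3 * q^12 + 2 * q^11 - q^6 + q^4
  | 25 => q^23 + q^12 - q^11 - q^3 - q^2 + q
  | 26 => q^24 - q^12
  | 27 => q^25 - q^13 + q^12 - q^7 + q^4 - q^3
  | 28 => q^26 - q^14
  | 29 => q^27 + q^14 - q^13 - 1
  | 30 => q^28 - 2 * q^15 + q^14 - q^8 + 2 * q^3 - q^2
  | _ => 0

/-- `G_{0,3}(m)` for `1 ≤ m ≤ 30`, `q = 2^r`, `r` odd. -/
def tableOddZero (q : ℝ) : ℕ → ℝ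
  | 1 => 1
  | 2 => 0
  | 3 => 0
  | 4 => 0
  | 5 => q^3 - q^2 + q - 1
  | 6 => q^4 - q^2
  | 7 => q^5 + q^3 - q^2 - 1
  | 8 => q^6 - 3 * q^4 + 2 * q^3
  | 9 => q^7 + q^4 - q^3 - 1
  | 10 => q^8 - q^4
  | 11 => q^9 - q^5 + q^4 - 1
  | 12 => q^10 - q^6
  | 13 => q^11 - q^6 + q^5 - 1
  | 14 => q^12 - q^6
  | 15 => q^13 + q^7 - q^6 - q^3 + q^2 - q
  | 16 => q^14 - 3 * q^8 + 2 * q^7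
  | 17 => q^15 + q^8 - q^7 - 1
  | 18 => q^16 - q^8 - q^4 + q^2
  | 19 => q^17 - q^9 + q^8 - 1
  | 20 => q^18 - q^10
  | 21 => q^19 - q^10 + q^9 - q^5 - q^3 + q^2
  | 22 => q^20 - q^10
  | 23 => q^21 + q^11 - q^10 - 1
  | 24 => q^22 - 3 * q^12 + 2 * q^11 - q^6 + 3 * q^4 - 2 * q^3
  | 25 => q^23 + q^12 - q^11 - q^3 + q^2 - q
  | 26 => q^24 - q^12
  | 27 => q^25 - q^13 + q^12 - q^7 - q^4 + q^3
  | 28 => q^26 - q^14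
  | 29 => q^27 - q^14 + q^13 - 1
  | 30 => q^28 - q^14 - q^8 + q^2
  | _ => 0

/-- `G_{c,3}(m)` for `1 ≤ m ≤ 30`, `q = 2^r`, `r` odd, `c ≠ 0`. -/
def tableOddNonzero (q : ℝ) : ℕ → ℝ
  | 1 => 0
  | 2 => 0
  | 3 => q + 1
  | 4 => q^2
  | 5 => q^3 + q
  | 6 => q^4 - q^2
  | 7 => q^5 - q^2
  | 8 => q^6 + 2 * q^3
  | 9 => q^7 - q^3 - q - 1
  | 10 => q^8 - q^4
  | 11 => q^9 + q^4
  | 12 => q^10 - q^2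
  | 13 => q^11 + q^5
  | 14 => q^12 - q^6
  | 15 => q^13 - q^6 - q^3 - 2 * q - 1
  | 16 => q^14 + 2 * q^7
  | 17 => q^15 - q^7
  | 18 => q^16 - q^8 - q^4 + q^2
  | 19 => q^17 + q^8
  | 20 => q^18 - q^2
  | 21 => q^19 + q^9 - q^5 + q^2 - q - 1
  | 22 => q^20 - q^10
  | 23 => q^21 - q^10
  | 24 => q^22 + 2 * q^11 - q^6 - 2 * q^3
  | 25 => q^23 - q^11 - q^3 - q
  | 26 => q^24 - q^12
  | 27 => q^25 + q^12 - q^7 + q^3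
  | 28 => q^26 - q^2
  | 29 => q^27 + q^13
  | 30 => q^28 - q^14 - q^8 + q^2
  | _ => 0

/-- `G_{c,3}(m)` for `1 ≤ m ≤ 30`, `q = 2^r`, `r` even, `c ∈ ⟨γ^3⟩`, where
`s = q^{1/2}` and `ε = (-1)^{r/2}`. -/
def tableEvenCube (q s ε : ℝ) : ℕ → ℝ
  | 1 => 0
  | 2 => 0
  | 3 => q - ε * 2 * s + 1
  | 4 => q^2 + ε * 2 * s^3
  | 5 => q^3 - q
  | 6 => q^4 - ε * 2 * s^5 + q^2
  | 7 => q^5 - q^2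
  | 8 => q^6 + ε * 2 * s^7
  | 9 => q^7 - ε * 2 * s^7 + q^3 - q + ε * 2 * s - 1
  | 10 => q^8 - q^4
  | 11 => q^9 - q^4
  | 12 => q^10 + 2 * q^5 - q^2 - ε * 2 * s^3
  | 13 => q^11 - q^5
  | 14 => q^12 - q^6
  | 15 => q^13 - ε * 2 * s^13 + q^6 - q^3 + ε * 2 * s - 1
  | 16 => q^14 + ε * 2 * s^15
  | 17 => q^15 - q^7
  | 18 => q^16 - ε * 2 * s^17 + q^8 - q^4 + ε * 2 * s^5 - q^2
  | 19 => q^17 - q^8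
  | 20 => q^18 + ε * 2 * s^19 - q^2 - ε * 2 * s^3
  | 21 => q^19 - ε * 2 * s^19 + q^9 - q^5 + q^2 - q + ε * 2 * s - 1
  | 22 => q^20 - q^10
  | 23 => q^21 - q^10
  | 24 => q^22 + 2 * q^11 - q^6 - ε * 2 * s^7
  | 25 => q^23 - q^11 - q^3 + q
  | 26 => q^24 - q^12
  | 27 => q^25 - ε * 2 * s^25 + q^12 - q^7 + ε * 2 * s^7 - q^3
  | 28 => q^26 + ε * 2 * s^27 - q^2 - ε * 2 * s^3
  | 29 => q^27 - q^13
  | 30 => q^28 - ε * 2 * s^29 + q^14 - q^8 + ε * 2 * s^5 - q^2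
  | _ => 0

/-- `G_{c,3}(m)` for `1 ≤ m ≤ 30`, `q = 2^r`, `r` even, `c ≠ 0`, `c ∉ ⟨γ^3⟩`, where
`s = q^{1/2}` and `ε = (-1)^{r/2}`. -/
def tableEvenNoncube (q s ε : ℝ) : ℕ → ℝ
  | 1 => 0
  | 2 => 0
  | 3 => q + ε * s + 1
  | 4 => q^2 - ε * s^3
  | 5 => q^3 - q
  | 6 => q^4 + ε * s^5 + q^2
  | 7 => q^5 - q^2
  | 8 => q^6 - ε * s^7
  | 9 => q^7 + ε * s^7 + q^3 - q - ε * s - 1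
  | 10 => q^8 - q^4
  | 11 => q^9 - q^4
  | 12 => q^10 + 2 * q^5 - q^2 + ε * s^3
  | 13 => q^11 - q^5
  | 14 => q^12 - q^6
  | 15 => q^13 + ε * s^13 + q^6 - q^3 - ε * s - 1
  | 16 => q^14 - ε * s^15
  | 17 => q^15 - q^7
  | 18 => q^16 + ε * s^17 + q^8 - q^4 - ε * s^5 - q^2
  | 19 => q^17 - q^8
  | 20 => q^18 - ε * s^19 - q^2 + ε * s^3
  | 21 => q^19 + ε * s^19 + q^9 - q^5 + q^2 - q - ε * s - 1
  | 22 => q^20 - q^10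
  | 23 => q^21 - q^10
  | 24 => q^22 + 2 * q^11 - q^6 + ε * s^7
  | 25 => q^23 - q^11 - q^3 + q
  | 26 => q^24 - q^12
  | 27 => q^25 + ε * s^25 + q^12 - q^7 - ε * s^7 - q^3
  | 28 => q^26 - ε * s^27 - q^2 + ε * s^3
  | 29 => q^27 - q^13
  | 30 => q^28 + ε * s^29 + q^14 - q^8 - ε * s^5 - q^2
  | _ => 0

end

/-!
The number of monic irreducible polynomials over `𝔽_q`, `q = 2 ^ r`, with two prescribed
coefficients is found from an `L`-function over `𝔽_q[x]`; extension fields enter only when these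
polynomials are compared with the elements counted by `countG`.

Let `χ` be the additive character `(-1) ^ Tr` of `F = 𝔽_q`.  For a monic polynomial `f` let `p₁` and
`p₃` be the sum of its roots and the sum of their cubes, and give `f` the weight
`χ (b p₃ + a p₁)`.  In characteristic two `p₃ = e₁³ + e₁ e₂ + e₃`, and the weight is completely
multiplicative.  For `b ≠ 0` its `L`-function is a polynomial of degree two, namely
`1 + s T + q T²` with `s = ∑ z, χ (b z³ + a z)`: in degree at least three the coefficient `e₃` is
free and the sum cancels.  Comparing with the Euler product (`MonicMultiplicative.mul_lCoeff`) gives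
the recurrence `S_n = -s S_{n-1} - q S_{n-2}` for the sums
`S_n = ∑_{d ∣ n} ∑_{deg P = d} d λ(P) ^ (n / d)` over monic irreducibles, `λ` being the weight
(`primeSum_weight_add_three`).

The form `z ↦ Tr (b z³)` is quadratic over `𝔽₂`, with radical `{w | w = 0 ∨ b w³ = 1}` of order `κ`.
Hence `s³ = κ q s` (`cubicSum_cube`), so that `S_n` is a combination of `1`, `s` and `s²`.  As
`∑_a s = q` and `∑_a s² = q²`, summing over `a` yields an integer depending only on `κ` and `n`,
times `q ^ (n / 2 + 1)` (`sum_primeSum_weight`).  Orthogonality in `a` and `b` then evaluates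
`∑ d N_d` over the divisors `d` of `m` with `m / d` odd, where `N_d` is the required number of
irreducible polynomials of degree `d` (`sum_odd_divisors_numIrreducible`); when `m / d` is even the
two conditions on `P ^ (m / d)` read `0 = 0` and `0 = c`, which gives the term `q ^ (m / 2)` for
`c = 0`.

If `r` is odd, every element is a cube and `κ = 2` throughout.  If `r` is even, `κ` is `4` or `1`
according as `b` is a cube or not, and there remains the sum `∑ z, χ (c z³)`.  It is `± 2 √q` or
`± √q`, and it is `1` modulo `3`, which fixes the sign (`cubicSum_zero_left`).

The divisor sums determine `d N_d` recursively, and the tables satisfy the same identities.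
Finally `countG` is `m N_m`, each irreducible polynomial of degree `m` being the minimal polynomial
of exactly `m` elements of `K` (`countG_eq_mul_numIrreducible`).
-/

open Polynomial Finset UniqueFactorizationMonoid

section

variable {F : Type*} [Field F]

/-! ### Monic polynomials over a finite field -/

open Classical in
theorem card_filter_pow_dvd {f P : F[X]} (hf : f.Monic) (hP : P.Monic) (hP' : Irreducible P) :
    #((Icc 1 f.natDegree).filter
      fun k => P.natDegree ∣ k ∧ P ^ (k / P.natDegree) ∣ f) =
      (normalizedFactors f).count P := by
  have hd : 0 < P.natDegree := hP'.natDegree_pos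
  have key (j : ℕ) : P ^ j ∣ f ↔ j ≤ (normalizedFactors f).count P := by
    rw [pow_dvd_iff_le_emultiplicity, emultiplicity_eq_count_normalizedFactors hP' hf.ne_zero,
      hP.normalize_eq_self]
    exact Nat.cast_le
  have hI : #(Icc 1 ((normalizedFactors f).count P)) = (normalizedFactors f).count P := by simp
  refine Eq.trans (Eq.symm ?_) hI
  refine card_bij (fun j _ => P.natDegree * j) ?_ ?_ ?_
  · intro j hj
    rw [mem_Icc] at hj
    have hdvd := (key j).2 hj.2
    have hle := natDegree_le_of_dvd hdvd hf.ne_zero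
    rw [natDegree_pow] at hle
    simp only [mem_filter, mem_Icc, Nat.mul_div_cancel_left _ hd, dvd_mul_right, true_and]
    exact ⟨⟨Nat.mul_pos hd hj.1, by rwa [mul_comm]⟩, hdvd⟩
  · intro a _ b _ h
    exact Nat.eq_of_mul_eq_mul_left hd h
  · intro k hk
    simp only [mem_filter, mem_Icc] at hk
    obtain ⟨⟨h1, -⟩, ⟨j, rfl⟩, h3⟩ := hk
    rw [Nat.mul_div_cancel_left _ hd, key] at h3
    exact ⟨j, mem_Icc.2 ⟨Nat.pos_of_mul_pos_left h1, h3⟩, rfl⟩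

/-- A function on polynomials which is completely multiplicative on the monic ones. -/
structure MonicMultiplicative (lam : F[X] → ℤ) : Prop where
  map_one : lam 1 = 1
  map_mul : ∀ f g : F[X], f.Monic → g.Monic → lam (f * g) = lam f * lam g

theorem MonicMultiplicative.map_pow {lam : F[X] → ℤ} (h : MonicMultiplicative lam) {P : F[X]}
    (hP : P.Monic) (j : ℕ) : lam (P ^ j) = lam P ^ j := by
  induction j with
  | zero => simpa using h.map_one
  | succ j ih => rw [pow_succ, h.map_mul _ _ (hP.pow j) hP, ih, pow_succ]

theorem finite_setOf_monic_natDegree_eq (F : Type*) [Field F] [Finite F] (n : ℕ) :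
    {f : F[X] | f.Monic ∧ f.natDegree = n}.Finite := by
  have : Finite (degreeLT F n) := Finite.of_equiv _ (degreeLTEquiv F n).toEquiv.symm
  have : Finite {f : F[X] // f.Monic ∧ f.natDegree = n} :=
    Finite.of_equiv _ (monicEquivDegreeLT (R := F) n).symm
  exact Set.finite_coe_iff.1 this

/-- The monic polynomials of degree `n` over a finite field. -/
noncomputable def monics (F : Type*) [Field F] [Finite F] (n : ℕ) : Finset F[X] :=
  (finite_setOf_monic_natDegree_eq F n).toFinset

open Classical in
/-- The monic irreducible polynomials of degree `n` over a finite field. -/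
noncomputable def irreds (F : Type*) [Field F] [Finite F] (n : ℕ) : Finset F[X] :=
  (monics F n).filter Irreducible

variable [Finite F]

@[simp]
theorem mem_monics {n : ℕ} {f : F[X]} : f ∈ monics F n ↔ f.Monic ∧ f.natDegree = n := by
  simp [monics]

@[simp]
theorem mem_irreds {n : ℕ} {f : F[X]} :
    f ∈ irreds F n ↔ (f.Monic ∧ f.natDegree = n) ∧ Irreducible f := by
  simp [irreds]

theorem card_monics (n : ℕ) : #(monics F n) = Nat.card F ^ n := by
  have h : Nat.card {f : F[X] // f.Monic ∧ f.natDegree = n} = Nat.card F ^ n := by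
    rw [Nat.card_congr (monicEquivDegreeLT (R := F) n),
      Nat.card_congr (degreeLTEquiv F n).toEquiv, Nat.card_fun, Nat.card_fin]
  rw [← h, monics, ← Set.ncard_eq_toFinset_card _ (finite_setOf_monic_natDegree_eq F n)]
  rfl

theorem monics_zero : monics F 0 = {1} := by
  ext f
  rw [mem_monics, mem_singleton]
  exact ⟨fun h => eq_one_of_monic_natDegree_zero h.1 h.2, by rintro rfl; simp⟩

open Classical in
theorem numIrreducible_eq_card (c : F) (d : ℕ) :
    numIrreducible c d = #{f ∈ irreds F d | topCoeff f 1 = 0 ∧ topCoeff f 3 = c} := by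
  rw [numIrreducible, ← Set.ncard_coe_finset]
  congr 1
  ext f
  simp only [Set.mem_ofPred_eq, coe_filter, mem_irreds]
  tauto

open Classical in
theorem natDegree_eq_sum_count {f : F[X]} (hf : f.Monic) :
    f.natDegree = ∑ d ∈ Icc 1 f.natDegree, ∑ P ∈ irreds F d,
      d * (normalizedFactors f).count P := by
  have hmem {P : F[X]} (hP : P ∈ normalizedFactors f) : P.Monic :=
    (normalize_eq_self_iff_monic (irreducible_of_normalized_factor P hP).ne_zero).1
      (normalize_normalized_factor P hP)
  have h1 : f.natDegree = ((normalizedFactors f).map natDegree).sum := by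
    have h2 : (normalizedFactors f).prod = f := by
      rw [prod_normalizedFactors_eq hf.ne_zero, hf.normalize_eq_self]
    conv_lhs => rw [← h2]
    exact natDegree_multiset_prod_of_monic _ fun P hP => hmem hP
  conv_lhs => rw [h1, sum_multiset_map_count]
  rw [← sum_fiberwise_of_maps_to (g := natDegree) (t := Icc 1 f.natDegree)]
  · refine sum_congr rfl fun d _ => ?_
    have hsub : (normalizedFactors f).toFinset.filter (fun P => P.natDegree = d) ⊆
        irreds F d := by
      intro P hP
      rw [mem_filter, Multiset.mem_toFinset] at hP
      exact mem_irreds.2 ⟨⟨hmem hP.1, hP.2⟩, irreducible_of_normalized_factor P hP.1⟩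
    rw [← sum_subset hsub]
    · refine sum_congr rfl fun P hP => ?_
      rw [(mem_filter.1 hP).2, smul_eq_mul, mul_comm]
    · intro P hP hP'
      rw [mem_filter, Multiset.mem_toFinset, not_and'] at hP'
      rw [Multiset.count_eq_zero_of_notMem (hP' (mem_irreds.1 hP).1.2), mul_zero]
  · intro P hP
    rw [Multiset.mem_toFinset] at hP
    exact mem_Icc.2 ⟨(irreducible_of_normalized_factor P hP).natDegree_pos,
      natDegree_le_of_dvd (dvd_of_mem_normalizedFactors hP) hf.ne_zero⟩

open Classical in
/-- The degree of `f`, counted by the prime powers `P ^ j` dividing `f`, each of them with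
weight `deg P`; the index `k` is `deg (P ^ j)`. -/
theorem natDegree_eq_sum_pow_dvd {f : F[X]} (hf : f.Monic) :
    f.natDegree = ∑ k ∈ Icc 1 f.natDegree, ∑ d ∈ k.divisors, ∑ P ∈ irreds F d,
      if P ^ (k / d) ∣ f then d else 0 := by
  have h (k) (hk : k ∈ Icc 1 f.natDegree) :
      k.divisors = (Icc 1 f.natDegree).filter (· ∣ k) := by
    rw [mem_Icc] at hk
    ext d
    simp only [Nat.mem_divisors, mem_filter, mem_Icc]
    constructor
    · intro h
      exact ⟨⟨Nat.pos_of_dvd_of_pos h.1 hk.1, (Nat.le_of_dvd hk.1 h.1).trans hk.2⟩, h.1⟩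
    · intro h
      exact ⟨h.2, by omega⟩
  have h' : ∑ k ∈ Icc 1 f.natDegree, ∑ d ∈ k.divisors, ∑ P ∈ irreds F d,
      (if P ^ (k / d) ∣ f then d else 0) =
      ∑ k ∈ Icc 1 f.natDegree, ∑ d ∈ Icc 1 f.natDegree, ∑ P ∈ irreds F d,
      if d ∣ k ∧ P ^ (k / d) ∣ f then d else 0 := by
    refine sum_congr rfl fun k hk => ?_
    rw [h k hk, sum_filter]
    refine sum_congr rfl fun d _ => ?_
    split_ifs with hd <;> simp [hd]
  rw [h', sum_comm]
  conv_lhs => rw [natDegree_eq_sum_count hf]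
  refine sum_congr rfl fun d _ => ?_
  rw [sum_comm]
  refine sum_congr rfl fun P hP => ?_
  obtain ⟨⟨hP1, rfl⟩, hP2⟩ := mem_irreds.1 hP
  rw [← card_filter_pow_dvd hf hP1 hP2, ← sum_filter, sum_const, smul_eq_mul, mul_comm]

/-! ### The logarithmic derivative of an `L`-function -/

/-- The degree `n` coefficient of the `L`-function of `lam`: the sum of `lam` over monic
polynomials of degree `n`. -/
noncomputable def lCoeff (lam : F[X] → ℤ) (n : ℕ) : ℤ := ∑ f ∈ monics F n, lam f

/-- The `k`-th coefficient of the logarithmic derivative of the `L`-function of `lam`.  When `lam`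
comes from an additive character of `F` this is a character sum over the extension of `F` of
degree `k`, written as a sum over the minimal polynomials of its elements. -/
noncomputable def primeSum (lam : F[X] → ℤ) (k : ℕ) : ℤ :=
  ∑ d ∈ k.divisors, ∑ P ∈ irreds F d, d * lam P ^ (k / d)

open Classical in
theorem MonicMultiplicative.sum_filter_dvd {lam : F[X] → ℤ} (h : MonicMultiplicative lam)
    {Q : F[X]} (hQ : Q.Monic) {n : ℕ} (hn : Q.natDegree ≤ n) :
    ∑ f ∈ (monics F n).filter (Q ∣ ·), lam f = lam Q * lCoeff lam (n - Q.natDegree) := by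
  rw [lCoeff, mul_sum]
  symm
  refine sum_bij (fun g _ => Q * g) ?_ ?_ ?_ ?_
  · intro g hg
    obtain ⟨hg1, hg2⟩ := mem_monics.1 hg
    simp only [mem_filter, mem_monics, dvd_mul_right, and_true]
    exact ⟨hQ.mul hg1, by rw [hQ.natDegree_mul hg1, hg2]; omega⟩
  · intro a _ b _ hab
    exact mul_left_cancel₀ hQ.ne_zero hab
  · intro f hf
    simp only [mem_filter, mem_monics] at hf
    obtain ⟨⟨hf1, hf2⟩, g, rfl⟩ := hf
    have hg : g.Monic := hQ.of_mul_monic_left hf1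
    rw [hQ.natDegree_mul hg] at hf2
    exact ⟨g, mem_monics.2 ⟨hg, by omega⟩, rfl⟩
  · intro g hg
    rw [h.map_mul _ _ hQ (mem_monics.1 hg).1]

/-- The Euler product, in the form `T L' = L · (T L' / L)` compared coefficientwise. -/
theorem MonicMultiplicative.mul_lCoeff {lam : F[X] → ℤ} (h : MonicMultiplicative lam) (n : ℕ) :
    n * lCoeff lam n = ∑ k ∈ Icc 1 n, primeSum lam k * lCoeff lam (n - k) := by
  classical
  have h1 : n * lCoeff lam n = ∑ f ∈ monics F n, ∑ k ∈ Icc 1 n, ∑ d ∈ k.divisors,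
      ∑ P ∈ irreds F d, if P ^ (k / d) ∣ f then d * lam f else 0 := by
    rw [lCoeff, mul_sum]
    refine sum_congr rfl fun f hf => ?_
    obtain ⟨hf1, hf2⟩ := mem_monics.1 hf
    have := natDegree_eq_sum_pow_dvd hf1
    rw [hf2] at this
    conv_lhs => rw [this]
    push_cast
    simp only [sum_mul, ite_mul, zero_mul]
  rw [h1, sum_comm]
  refine sum_congr rfl fun k hk => ?_
  rw [sum_comm, primeSum, sum_mul]
  refine sum_congr rfl fun d hd => ?_
  rw [sum_comm, sum_mul]
  refine sum_congr rfl fun P hP => ?_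
  obtain ⟨⟨hP1, hP2⟩, -⟩ := mem_irreds.1 hP
  obtain ⟨j, rfl⟩ := Nat.dvd_of_mem_divisors hd
  have hdeg : (P ^ (d * j / d)).natDegree = d * j := by
    rw [natDegree_pow, hP2, Nat.div_mul_cancel (dvd_mul_right d j)]
  rw [← sum_filter, ← mul_sum, h.sum_filter_dvd (hP1.pow _) (hdeg.le.trans (mem_Icc.1 hk).2),
    hdeg, h.map_pow hP1, mul_assoc]

theorem lCoeff_zero {lam : F[X] → ℤ} (h : MonicMultiplicative lam) : lCoeff lam 0 = 1 := by
  rw [lCoeff, monics_zero, sum_singleton, h.map_one]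

end

/-! ### Power sums of the roots, read off the coefficients -/

section

variable {F : Type*} [Field F]

theorem topCoeff_eq_coeff_reverse (P : F[X]) (k : ℕ) : topCoeff P k = P.reverse.coeff k := by
  rw [topCoeff, coeff_reverse]
  split_ifs with h
  · rw [revAt_le h]
  · rw [revAt_eq_self_of_lt (not_le.1 h), coeff_eq_zero_of_natDegree_lt (not_le.1 h)]

theorem topCoeff_zero {f : F[X]} (hf : f.Monic) : topCoeff f 0 = 1 := by
  simpa [topCoeff] using hf.leadingCoeff

theorem topCoeff_mul (f g : F[X]) (k : ℕ) :
    topCoeff (f * g) k = ∑ x ∈ antidiagonal k, topCoeff f x.1 * topCoeff g x.2 := by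
  simp_rw [topCoeff_eq_coeff_reverse, reverse_mul_of_domain, coeff_mul]

/-- In characteristic two, the sum of the cubes of the roots of a monic polynomial.  It is
Newton's formula `e₁ ^ 3 - 3 e₁ e₂ + 3 e₃`. -/
def cubeSum (f : F[X]) : F :=
  topCoeff f 1 ^ 3 + topCoeff f 1 * topCoeff f 2 + topCoeff f 3

theorem topCoeff_one_mul {f g : F[X]} (hf : f.Monic) (hg : g.Monic) :
    topCoeff (f * g) 1 = topCoeff f 1 + topCoeff g 1 := by
  simp [topCoeff_mul, Nat.antidiagonal_succ, topCoeff_zero hf, topCoeff_zero hg, add_comm]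

theorem cubeSum_mul [CharP F 2] {f g : F[X]} (hf : f.Monic) (hg : g.Monic) :
    cubeSum (f * g) = cubeSum f + cubeSum g := by
  have h2 : (2 : F) = 0 := CharTwo.two_eq_zero
  simp only [cubeSum, topCoeff_mul, Nat.antidiagonal_succ, Nat.antidiagonal_zero, sum_cons,
    map_singleton, map_cons, sum_singleton, topCoeff_zero hf, topCoeff_zero hg,
    Function.Embedding.prodMap, Function.Embedding.coeFn_mk, Prod.map,
    Function.Embedding.refl_apply, Nat.succ_eq_add_one]
  norm_num
  linear_combination (2 * topCoeff f 1 ^ 2 * topCoeff g 1 + 2 * topCoeff f 1 * topCoeff g 1 ^ 2 +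
    topCoeff f 1 * topCoeff g 2 + topCoeff f 2 * topCoeff g 1) * h2

theorem topCoeff_one {k : ℕ} (hk : k ≠ 0) : topCoeff (1 : F[X]) k = 0 := by
  simp [topCoeff, hk]

theorem topCoeff_X_add_C (z : F) (k : ℕ) :
    topCoeff (X + C z) k = if k = 0 then 1 else if k = 1 then z else 0 := by
  rcases k with _ | _ | k <;> simp [topCoeff]

theorem cubeSum_X_add_C (z : F) : cubeSum (X + C z) = z ^ 3 := by
  simp [cubeSum, topCoeff_X_add_C]

theorem natDegree_add_C_mul_X_pow {f : F[X]} (hf : f.Monic) {i : ℕ} (hi : 0 < i)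
    (hin : i ≤ f.natDegree) (t : F) :
    (f + C t * X ^ (f.natDegree - i)).Monic ∧
      (f + C t * X ^ (f.natDegree - i)).natDegree = f.natDegree := by
  have h : (C t * X ^ (f.natDegree - i)).degree < f.degree := by
    refine (degree_C_mul_X_pow_le _ _).trans_lt ?_
    rw [degree_eq_natDegree hf.ne_zero]
    exact_mod_cast (by omega : f.natDegree - i < f.natDegree)
  exact ⟨hf.add_of_left h, natDegree_add_eq_left_of_degree_lt h⟩

theorem topCoeff_add_C_mul_X_pow {f : F[X]} (hf : f.Monic) {i : ℕ} (hi : 0 < i)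
    (hin : i ≤ f.natDegree) (t : F) {k : ℕ} (hk : k ≤ f.natDegree) :
    topCoeff (f + C t * X ^ (f.natDegree - i)) k = topCoeff f k + if k = i then t else 0 := by
  have h := (natDegree_add_C_mul_X_pow hf hi hin t).2
  rw [topCoeff, topCoeff, h, if_pos hk, if_pos hk, coeff_add, coeff_C_mul_X_pow]
  congr 1
  exact if_congr (by omega) rfl rfl

/-! ### The weights attached to an additive character -/

/-- The function `f ↦ χ (b p₃(f) + a p₁(f))`, where `p₁(f)` and `p₃(f)` are the sum of the roots
and the sum of their cubes. -/
def weight (χ : AddChar F ℤ) (a b : F) (f : F[X]) : ℤ :=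
  χ (b * cubeSum f + a * topCoeff f 1)

theorem monicMultiplicative_weight [CharP F 2] (χ : AddChar F ℤ) (a b : F) :
    MonicMultiplicative (weight χ a b) where
  map_one := by simp [weight, cubeSum, topCoeff_one]
  map_mul f g hf hg := by
    rw [weight, cubeSum_mul hf hg, topCoeff_one_mul hf hg, weight, weight, ← AddChar.map_add_eq_mul]
    congr 1
    ring

theorem exists_mul_ne_one {χ : AddChar F ℤ} (hχ : χ ≠ 1) {c : F} (hc : c ≠ 0) :
    ∃ t, χ (c * t) ≠ 1 := by
  obtain ⟨x, hx⟩ := AddChar.ne_one_iff.1 hχ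
  exact ⟨c⁻¹ * x, by rwa [mul_inv_cancel_left₀ hc]⟩

variable [Finite F]

/-- If translating the coefficient of `X ^ (n - i)` multiplies `lam` by a constant other than `1`,
the sum of `lam` over monic polynomials of degree `n` vanishes. -/
theorem lCoeff_eq_zero_of_shift {lam : F[X] → ℤ} {n i : ℕ} (hi : 0 < i) (hin : i ≤ n) (t : F)
    {u : ℤ} (hu : u ≠ 1)
    (h : ∀ f : F[X], f.Monic → f.natDegree = n → lam (f + C t * X ^ (n - i)) = u * lam f) :
    lCoeff lam n = 0 := by
  have key : u * lCoeff lam n = lCoeff lam n := by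
    rw [lCoeff, mul_sum]
    have hmem (s : F) (f : F[X]) (hf : f ∈ monics F n) :
        f + C s * X ^ (n - i) ∈ monics F n := by
      obtain ⟨hf1, rfl⟩ := mem_monics.1 hf
      exact mem_monics.2 (natDegree_add_C_mul_X_pow hf1 hi hin s)
    refine sum_nbij' (fun f => f + C t * X ^ (n - i)) (fun f => f + C (-t) * X ^ (n - i))
      (hmem t) (hmem (-t)) ?_ ?_ ?_
    · intro f _
      simp
    · intro f _
      simp
    · intro f hf
      rw [h f (mem_monics.1 hf).1 (mem_monics.1 hf).2]
  have : (u - 1) * lCoeff lam n = 0 := by linear_combination key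
  exact (mul_eq_zero.1 this).resolve_left (sub_ne_zero.2 hu)

theorem lCoeff_weight_zero_right {χ : AddChar F ℤ} (hχ : χ ≠ 1) {a : F} (ha : a ≠ 0) {n : ℕ}
    (hn : 0 < n) : lCoeff (weight χ a 0) n = 0 := by
  obtain ⟨t, ht⟩ := exists_mul_ne_one hχ ha
  refine lCoeff_eq_zero_of_shift one_pos hn t ht fun f hf hfn => ?_
  subst hfn
  rw [weight, topCoeff_add_C_mul_X_pow hf one_pos hn t hn, weight, ← AddChar.map_add_eq_mul]
  congr 1
  simp
  ring

/-- The coefficient `e₃` enters `p₃` linearly and can be translated freely in degree at least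
three, so that the `L`-function is a polynomial. -/
theorem lCoeff_weight_of_three_le {χ : AddChar F ℤ} (hχ : χ ≠ 1) (a : F) {b : F} (hb : b ≠ 0)
    {n : ℕ} (hn : 3 ≤ n) : lCoeff (weight χ a b) n = 0 := by
  obtain ⟨t, ht⟩ := exists_mul_ne_one hχ hb
  refine lCoeff_eq_zero_of_shift three_pos hn t ht fun f hf hfn => ?_
  subst hfn
  rw [weight, cubeSum, topCoeff_add_C_mul_X_pow hf three_pos hn t hn,
    topCoeff_add_C_mul_X_pow hf three_pos hn t (by omega),
    topCoeff_add_C_mul_X_pow hf three_pos hn t (by omega), weight, ← AddChar.map_add_eq_mul]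
  congr 1
  simp [cubeSum]
  ring

end

section

variable {F : Type*} [Field F] [Fintype F]

/-- The exponential sum `∑ z, χ (b z ^ 3 + a z)` over `F`. -/
def cubicSum (χ : AddChar F ℤ) (a b : F) : ℤ := ∑ z : F, χ (b * z ^ 3 + a * z)

theorem lCoeff_weight_one (χ : AddChar F ℤ) (a b : F) :
    lCoeff (weight χ a b) 1 = cubicSum χ a b := by
  symm
  refine sum_bij (fun z _ => X + C z) ?_ ?_ ?_ ?_
  · intro z _
    simpa using monic_X_add_C z
  · intro z _ w _ h
    simpa using h
  · intro f hf
    obtain ⟨h1, h2⟩ := mem_monics.1 hf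
    exact ⟨f.coeff 0, mem_univ _, (h1.eq_X_add_C h2).symm⟩
  · intro z _
    simp [weight, cubeSum_X_add_C, topCoeff_X_add_C]

/-- In degree two `p₃ = u ^ 3 + u v` for `X ^ 2 + u X + v`; summing over `v` leaves `u = 0`. -/
theorem lCoeff_weight_two {χ : AddChar F ℤ} (hχ : χ ≠ 1) (a : F) {b : F} (hb : b ≠ 0) :
    lCoeff (weight χ a b) 2 = Fintype.card F := by
  classical
  have hdeg (u v : F) : (X ^ 2 + (C u * X + C v)).natDegree = 2 ∧
      (X ^ 2 + (C u * X + C v)).Monic := by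
    have h : (C u * X + C v).degree < ((2 : ℕ) : WithBot ℕ) :=
      degree_linear_le.trans_lt (by norm_num)
    exact ⟨by rw [natDegree_add_eq_left_of_degree_lt (by simpa using h), natDegree_X_pow],
      monic_X_pow_add h⟩
  have h1 : lCoeff (weight χ a b) 2 =
      ∑ x : F × F, χ (b * (x.1 ^ 3 + x.1 * x.2) + a * x.1) := by
    symm
    refine sum_nbij' (fun x => X ^ 2 + (C x.1 * X + C x.2)) (fun f => (f.coeff 1, f.coeff 0))
      ?_ ?_ ?_ ?_ ?_
    · intro x _
      exact mem_monics.2 ⟨(hdeg _ _).2, (hdeg _ _).1⟩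
    · simp
    · rintro ⟨u, v⟩ _
      simp [coeff_X]
    · intro f hf
      obtain ⟨hf1, hf2⟩ := mem_monics.1 hf
      conv_rhs => rw [f.as_sum_range_C_mul_X_pow, hf2]
      have : f.coeff 2 = 1 := by rw [← hf2]; exact hf1
      simp [sum_range_succ, this]
      ring
    · rintro ⟨u, v⟩ _
      simp only [weight, cubeSum, topCoeff, (hdeg u v).1]
      simp [coeff_X]
  rw [h1, Fintype.sum_prod_type]
  have h2 (u : F) : ∑ v : F, χ (b * (u ^ 3 + u * v) + a * u) =
      if u = 0 then (Fintype.card F : ℤ) else 0 := by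
    have := AddChar.sum_mulShift (ψ := χ) (b * u) (AddChar.IsPrimitive.of_ne_one hχ)
    calc ∑ v : F, χ (b * (u ^ 3 + u * v) + a * u)
        = χ (b * u ^ 3 + a * u) * ∑ v : F, χ (v * (b * u)) := by
          rw [mul_sum]
          refine sum_congr rfl fun v _ => ?_
          rw [← AddChar.map_add_eq_mul]
          congr 1
          ring
      _ = _ := by
          rw [this]
          by_cases hu : u = 0 <;> simp [hu, hb]
  simp [h2]

/-! ### Recurrences for the character sums over extensions -/

theorem primeSum_weight_zero_right [CharP F 2] {χ : AddChar F ℤ} (hχ : χ ≠ 1) {a : F}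
    (ha : a ≠ 0) {n : ℕ} (hn : 0 < n) : primeSum (weight χ a 0) n = 0 := by
  have hm := monicMultiplicative_weight χ a 0
  obtain ⟨n, rfl⟩ := Nat.exists_eq_add_one_of_ne_zero hn.ne'
  have h := hm.mul_lCoeff (n + 1)
  rw [lCoeff_weight_zero_right hχ ha hn, sum_Icc_succ_top (by omega), Nat.sub_self,
    lCoeff_zero hm, sum_eq_zero] at h
  · linear_combination -h
  · intro k hk
    rw [mem_Icc] at hk
    rw [lCoeff_weight_zero_right hχ ha (by omega), mul_zero]

theorem primeSum_weight_zero_zero [CharP F 2] (χ : AddChar F ℤ) {n : ℕ} (hn : 0 < n) :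
    primeSum (weight χ 0 0) n = (Fintype.card F : ℤ) ^ n := by
  have hm := monicMultiplicative_weight χ 0 0
  have hA (k : ℕ) : lCoeff (weight χ 0 0) k = (Fintype.card F : ℤ) ^ k := by
    simp [lCoeff, weight, card_monics]
  induction n using Nat.strong_induction_on with
  | _ n ih =>
    obtain ⟨n, rfl⟩ := Nat.exists_eq_add_one_of_ne_zero hn.ne'
    have h := hm.mul_lCoeff (n + 1)
    have h' : ∑ k ∈ Icc 1 n, primeSum (weight χ 0 0) k * lCoeff (weight χ 0 0) (n + 1 - k) =
        n * (Fintype.card F : ℤ) ^ (n + 1) := by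
      rw [sum_congr rfl (g := fun _ => (Fintype.card F : ℤ) ^ (n + 1))]
      · simp
      · intro k hk
        rw [mem_Icc] at hk
        rw [ih k (by omega) (by omega), hA, ← pow_add]
        congr 1
        omega
    rw [sum_Icc_succ_top (by omega), h', hA, hA] at h
    push_cast at h
    simp only [Nat.sub_self, pow_zero] at h
    linear_combination -h

section

variable [CharP F 2] {χ : AddChar F ℤ}

theorem primeSum_weight_one (a b : F) :
    primeSum (weight χ a b) 1 = cubicSum χ a b := by
  have hm := monicMultiplicative_weight χ a b
  have h := hm.mul_lCoeff 1
  simp [lCoeff_zero hm, lCoeff_weight_one] at h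
  exact h.symm

theorem primeSum_weight_two (hχ : χ ≠ 1) (a : F) {b : F} (hb : b ≠ 0) :
    primeSum (weight χ a b) 2 = 2 * Fintype.card F - cubicSum χ a b ^ 2 := by
  have hm := monicMultiplicative_weight χ a b
  have h := hm.mul_lCoeff 2
  simp [sum_Icc_succ_top, lCoeff_zero hm, lCoeff_weight_one, lCoeff_weight_two hχ a hb,
    primeSum_weight_one] at h
  linear_combination -h

theorem primeSum_weight_add_three (hχ : χ ≠ 1) (a : F) {b : F} (hb : b ≠ 0) (n : ℕ) :
    primeSum (weight χ a b) (n + 3) = -cubicSum χ a b * primeSum (weight χ a b) (n + 2) -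
      Fintype.card F * primeSum (weight χ a b) (n + 1) := by
  have hm := monicMultiplicative_weight χ a b
  have h := hm.mul_lCoeff (n + 3)
  rw [sum_Icc_succ_top (by omega), sum_Icc_succ_top (by omega), sum_Icc_succ_top (by omega),
    sum_eq_zero, lCoeff_weight_of_three_le hχ a hb (by omega),
    show n + 3 - (n + 3) = 0 by omega, show n + 3 - (n + 1 + 1) = 1 by omega,
    show n + 3 - (n + 1) = 2 by omega, lCoeff_zero hm, lCoeff_weight_one,
    lCoeff_weight_two hχ a hb] at h
  · linear_combination -h
  · intro k hk
    rw [mem_Icc] at hk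
    rw [lCoeff_weight_of_three_le hχ a hb (by omega), mul_zero]

/-- The coefficients `(α, β, γ)` of the solution of the recurrence for the power sums: if
`s ^ 3 = κ q s`, the power sums of index `2 k` and `2 k + 1` are `α q ^ k + β q ^ (k - 1) s ^ 2`
and `γ q ^ k s`. -/
def powerSumCoeff (κ : ℤ) : ℕ → ℤ × ℤ × ℤ
  | 0 => (-2, 0, 1)
  | k + 1 =>
    let p := powerSumCoeff κ k
    (-p.1, -p.2.2 - p.2.1, p.1 + κ * (p.2.2 + p.2.1) - p.2.2)

theorem primeSum_weight_eq (hχ : χ ≠ 1) (a : F) {b : F} (hb : b ≠ 0) {κ : ℤ}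
    (hκ : cubicSum χ a b ^ 3 = κ * Fintype.card F * cubicSum χ a b) (k : ℕ) :
    primeSum (weight χ a b) (2 * k + 1) =
        (powerSumCoeff κ k).2.2 * Fintype.card F ^ k * cubicSum χ a b ∧
      primeSum (weight χ a b) (2 * k + 2) =
        (powerSumCoeff κ (k + 1)).1 * Fintype.card F ^ (k + 1) +
          (powerSumCoeff κ (k + 1)).2.1 * Fintype.card F ^ k * cubicSum χ a b ^ 2 := by
  induction k with
  | zero =>
    simp only [mul_zero, zero_add, primeSum_weight_one, primeSum_weight_two hχ a hb,
      powerSumCoeff]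
    constructor <;> ring
  | succ k ih =>
    obtain ⟨ih1, ih2⟩ := ih
    have h1 : primeSum (weight χ a b) (2 * (k + 1) + 1) =
        (powerSumCoeff κ (k + 1)).2.2 * Fintype.card F ^ (k + 1) * cubicSum χ a b := by
      rw [show 2 * (k + 1) + 1 = 2 * k + 3 by ring, primeSum_weight_add_three hχ a hb, ih1, ih2]
      simp only [powerSumCoeff]
      linear_combination
        ((powerSumCoeff κ k).2.2 + (powerSumCoeff κ k).2.1) * (Fintype.card F : ℤ) ^ k * hκ
    refine ⟨h1, ?_⟩
    rw [show 2 * (k + 1) + 2 = (2 * k + 1) + 3 by ring, primeSum_weight_add_three hχ a hb,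
      show 2 * k + 1 + 2 = 2 * (k + 1) + 1 by ring, show 2 * k + 1 + 1 = 2 * k + 2 by ring,
      h1, ih2]
    rw [powerSumCoeff.eq_2 κ (k + 1)]
    ring

end

end

/-! ### Exponential sums of cubics over a field of characteristic two -/

section

variable {F : Type*} [Field F]

theorem sum_cubicSum [Fintype F] {χ : AddChar F ℤ} (hχ : χ ≠ 1) (b : F) :
    ∑ a, cubicSum χ a b = Fintype.card F := by
  classical
  simp_rw [cubicSum]
  rw [sum_comm]
  have h (z : F) : ∑ a, χ (b * z ^ 3 + a * z) = if z = 0 then (Fintype.card F : ℤ) else 0 := by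
    simp_rw [AddChar.map_add_eq_mul, ← mul_sum,
      AddChar.sum_mulShift z (AddChar.IsPrimitive.of_ne_one hχ)]
    by_cases hz : z = 0 <;> simp [hz]
  simp [h]

variable [CharP F 2]

/-- The canonical additive character of a finite field of characteristic two, `(-1)` to the
absolute trace, is nontrivial and invariant under Frobenius. -/
theorem exists_frobenius_invariant_addChar (F : Type*) [Field F] [Finite F] [CharP F 2] :
    ∃ χ : AddChar F ℤ, χ ≠ 1 ∧ ∀ x, χ (x ^ 2) = χ x := by
  let _ : Algebra (ZMod 2) F := ZMod.algebra F 2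
  have h1 : (-1 : ℤ) ^ 2 = 1 := by norm_num
  refine ⟨(AddChar.zmodChar 2 h1).compAddMonoidHom
    (Algebra.trace (ZMod 2) F).toAddMonoidHom, ?_, ?_⟩
  · obtain ⟨x, hx⟩ := Algebra.trace_surjective (ZMod 2) F 1
    refine AddChar.ne_one_iff.2 ⟨x, ?_⟩
    simp only [AddChar.compAddMonoidHom_apply, LinearMap.toAddMonoidHom_coe, hx,
      AddChar.zmodChar_apply]
    decide
  · intro x
    have : Algebra.trace (ZMod 2) F (x ^ 2) = Algebra.trace (ZMod 2) F x := by
      have h := Algebra.trace_eq_of_algEquiv (FiniteField.frobeniusAlgEquivOfAlgebraic (ZMod 2) F) x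
      rwa [FiniteField.coe_frobeniusAlgEquivOfAlgebraic, ZMod.card] at h
    simp [this]

theorem AddChar.mul_self_eq_one (χ : AddChar F ℤ) (x : F) : χ x * χ x = 1 := by
  rw [← AddChar.map_add_eq_mul, CharTwo.add_self_eq_zero, AddChar.map_zero_eq_one]

theorem weight_pow (χ : AddChar F ℤ) (a b : F) (f : F[X]) (j : ℕ) :
    weight χ a b f ^ j = if Even j then 1 else weight χ a b f := by
  have h : weight χ a b f ^ 2 = 1 := by rw [sq]; exact AddChar.mul_self_eq_one χ _
  rcases Nat.even_or_odd' j with ⟨k, rfl | rfl⟩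
  · simp [pow_mul, h]
  · simp [pow_succ, pow_mul, h]

variable [Fintype F] {χ : AddChar F ℤ}

theorem sum_cubicSum_sq (hχ : χ ≠ 1) (b : F) :
    ∑ a, cubicSum χ a b ^ 2 = (Fintype.card F : ℤ) ^ 2 := by
  classical
  simp_rw [cubicSum, sq, sum_mul_sum]
  rw [sum_comm]
  have h (z w : F) : ∑ a, χ (b * z ^ 3 + a * z) * χ (b * w ^ 3 + a * w) =
      if z = w then (Fintype.card F : ℤ) else 0 := by
    have h1 (a : F) : χ (b * z ^ 3 + a * z) * χ (b * w ^ 3 + a * w) =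
        χ (b * z ^ 3 + b * w ^ 3) * χ (a * (z + w)) := by
      rw [← AddChar.map_add_eq_mul, ← AddChar.map_add_eq_mul]
      congr 1
      ring
    simp_rw [h1, ← mul_sum, AddChar.sum_mulShift (z + w) (AddChar.IsPrimitive.of_ne_one hχ),
      CharTwo.add_eq_zero]
    by_cases hz : z = w
    · subst hz
      simp [CharTwo.add_self_eq_zero]
    · simp [hz]
  have h2 (z : F) : ∑ a, ∑ w, χ (b * z ^ 3 + a * z) * χ (b * w ^ 3 + a * w) =
      Fintype.card F := by
    rw [sum_comm]
    simp [h]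
  simp [h2]

open Classical in
/-- The number of `w` in the radical of the quadratic form `z ↦ Tr (b z ^ 3)`. -/
noncomputable def radicalCard (b : F) : ℕ := #{w : F | b * w + b ^ 2 * w ^ 4 = 0}

open Classical in
theorem radicalCard_eq {b : F} (hb : b ≠ 0) : radicalCard b = #{w : F | b * w ^ 3 = 1} + 1 := by
  have : ({w : F | b * w + b ^ 2 * w ^ 4 = 0} : Finset F) =
      insert 0 ({w : F | b * w ^ 3 = 1} : Finset F) := by
    ext w
    simp only [mem_filter, mem_univ, true_and, mem_insert]
    rw [show b * w + b ^ 2 * w ^ 4 = b * (w * (1 + b * w ^ 3)) by ring, mul_eq_zero,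
      or_iff_right hb, mul_eq_zero, CharTwo.add_eq_zero, eq_comm (a := (1 : F))]
  rw [radicalCard, this, card_insert_of_notMem (by simp)]

open Classical in
/-- After substituting `z + w` for the second variable of the double sum, Frobenius invariance of
`χ` makes the exponent linear in `z ^ 2`. -/
theorem cubicSum_sq (hχ : χ ≠ 1) (hF : ∀ x, χ (x ^ 2) = χ x) (a b : F) :
    cubicSum χ a b ^ 2 = Fintype.card F *
      ∑ w ∈ ({w : F | b * w + b ^ 2 * w ^ 4 = 0} : Finset F), χ (b * w ^ 3 + a * w) := by
  have h1 : cubicSum χ a b ^ 2 =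
      ∑ z, ∑ w, χ (b * z ^ 3 + a * z) * χ (b * (z + w) ^ 3 + a * (z + w)) := by
    rw [sq, cubicSum, sum_mul_sum]
    refine sum_congr rfl fun z _ => ?_
    exact (Equiv.sum_comp (Equiv.addLeft z)
      fun w => χ (b * z ^ 3 + a * z) * χ (b * w ^ 3 + a * w)).symm
  have h2 (z w : F) : χ (b * z ^ 3 + a * z) * χ (b * (z + w) ^ 3 + a * (z + w)) =
      χ (b * w ^ 3 + a * w) * χ (z ^ 2 * (b * w + b ^ 2 * w ^ 4)) := by
    rw [mul_add (z ^ 2), AddChar.map_add_eq_mul _ (z ^ 2 * (b * w)),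
      show z ^ 2 * (b ^ 2 * w ^ 4) = (z * b * w ^ 2) ^ 2 by ring, hF]
    simp only [← AddChar.map_add_eq_mul]
    congr 1
    have h0 : (2 : F) = 0 := CharTwo.two_eq_zero
    linear_combination (b * z ^ 3 + a * z + b * z ^ 2 * w + b * z * w ^ 2) * h0
  have h3 (w : F) : ∑ z, χ (z ^ 2 * (b * w + b ^ 2 * w ^ 4)) =
      if b * w + b ^ 2 * w ^ 4 = 0 then (Fintype.card F : ℤ) else 0 := by
    have hbij : Function.Bijective (fun z : F => z ^ 2) :=
      Finite.injective_iff_bijective.1 (frobenius_inj F 2)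
    rw [hbij.sum_comp (fun y => χ (y * (b * w + b ^ 2 * w ^ 4))),
      AddChar.sum_mulShift _ (AddChar.IsPrimitive.of_ne_one hχ)]
    split_ifs <;> simp
  rw [h1, sum_comm]
  simp_rw [h2, ← mul_sum, h3]
  rw [mul_sum, sum_filter]
  refine sum_congr rfl fun w _ => ?_
  split_ifs <;> ring

/-- The square of a cubic sum is `q` times the sum of a character over the radical; hence it is
`0` or `q` times the order of the radical. -/
theorem cubicSum_cube (hχ : χ ≠ 1) (hF : ∀ x, χ (x ^ 2) = χ x) (a b : F) :
    cubicSum χ a b ^ 3 = radicalCard b * Fintype.card F * cubicSum χ a b := by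
  classical
  set R : Finset F := {w : F | b * w + b ^ 2 * w ^ 4 = 0} with hR
  set ρ : ℤ := ∑ w ∈ R, χ (b * w ^ 3 + a * w) with hρ
  have hmem {w : F} : w ∈ R ↔ b * w + b ^ 2 * w ^ 4 = 0 := by simp [hR]
  have hadd {v w : F} (hv : v ∈ R) (hw : w ∈ R) : v + w ∈ R := by
    rw [hmem] at *
    have h0 : (2 : F) = 0 := CharTwo.two_eq_zero
    linear_combination hv + hw + b ^ 2 *
      (2 * v ^ 3 * w + 3 * v ^ 2 * w ^ 2 + 2 * v * w ^ 3) * h0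
  have hmul {v w : F} (hw : w ∈ R) :
      χ (b * v ^ 3 + a * v) * χ (b * w ^ 3 + a * w) =
        χ (b * (v + w) ^ 3 + a * (v + w)) := by
    rw [hmem, CharTwo.add_eq_zero] at hw
    have h0 : (2 : F) = 0 := CharTwo.two_eq_zero
    -- the polar form vanishes on the radical
    have h1 : χ (b * v ^ 2 * w + b * v * w ^ 2) = 1 := by
      rw [AddChar.map_add_eq_mul, ← hF (b * v * w ^ 2),
        show (b * v * w ^ 2) ^ 2 = v ^ 2 * (b ^ 2 * w ^ 4) by ring, ← hw,
        show v ^ 2 * (b * w) = b * v ^ 2 * w by ring, AddChar.mul_self_eq_one]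
    rw [← mul_one (_ * _), ← h1]
    simp only [← AddChar.map_add_eq_mul]
    congr 1
    linear_combination -(b * v ^ 2 * w + b * v * w ^ 2) * h0
  have hsq : ρ ^ 2 = radicalCard b * ρ := by
    have hinner (v : F) (hv : v ∈ R) :
        ∑ w ∈ R, χ (b * v ^ 3 + a * v) * χ (b * w ^ 3 + a * w) = ρ := by
      have hcancel (w : F) : v + (v + w) = w := by
        rw [← add_assoc, CharTwo.add_self_eq_zero, zero_add]
      refine sum_nbij' (fun w => v + w) (fun w => v + w) (fun w hw => hadd hv hw)
        (fun w hw => hadd hv hw) (fun w _ => hcancel w) (fun w _ => hcancel w)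
        (fun w hw => hmul hw)
    calc ρ ^ 2 = ∑ v ∈ R, ∑ w ∈ R, χ (b * v ^ 3 + a * v) * χ (b * w ^ 3 + a * w) := by
          rw [sq, hρ, sum_mul_sum]
      _ = ∑ v ∈ R, ρ := sum_congr rfl hinner
      _ = radicalCard b * ρ := by
          rw [sum_const, nsmul_eq_mul]
          rfl
  have hs : cubicSum χ a b ^ 2 = Fintype.card F * ρ := cubicSum_sq hχ hF a b
  have hρ' : ρ = 0 ∨ ρ = radicalCard b := by
    have : ρ * (ρ - radicalCard b) = 0 := by linear_combination hsq
    exact (mul_eq_zero.1 this).imp id sub_eq_zero.1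
  rcases hρ' with h | h
  · rw [h, mul_zero] at hs
    rw [pow_eq_zero_iff two_ne_zero |>.1 hs]
    ring
  · rw [pow_succ, hs, h]
    ring

/-- The integer `t` with `∑ a, ∑ z, χ (b z ^ 3 + a z) = t q ^ (n / 2 + 1)`, the inner sum being
over the extension of degree `n` and `κ` the order of the radical attached to `b`. -/
def normalizedSum (κ : ℤ) (n : ℕ) : ℤ :=
  if Even n then (powerSumCoeff κ (n / 2)).1 + (powerSumCoeff κ (n / 2)).2.1
  else (powerSumCoeff κ (n / 2)).2.2

theorem sum_primeSum_weight (hχ : χ ≠ 1) (hF : ∀ x, χ (x ^ 2) = χ x) {b : F} (hb : b ≠ 0)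
    {n : ℕ} (hn : 0 < n) :
    ∑ a, primeSum (weight χ a b) n =
      normalizedSum (radicalCard b) n * (Fintype.card F : ℤ) ^ (n / 2 + 1) := by
  have h (a : F) := primeSum_weight_eq hχ a hb (cubicSum_cube hχ hF a b)
  rcases Nat.even_or_odd' n with ⟨k, rfl | rfl⟩
  · obtain ⟨k, rfl⟩ := Nat.exists_eq_add_one_of_ne_zero (show k ≠ 0 by omega)
    simp_rw [show 2 * (k + 1) = 2 * k + 2 by ring, (h _ k).2, sum_add_distrib, ← mul_sum,
      sum_cubicSum_sq hχ]
    rw [normalizedSum, if_pos ⟨k + 1, by ring⟩, show (2 * k + 2) / 2 = k + 1 by omega]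
    simp
    ring
  · simp_rw [(h _ k).1, ← mul_sum, sum_cubicSum hχ]
    rw [normalizedSum, if_neg (by simp), show (2 * k + 1) / 2 = k by omega]
    ring

/-! ### Counting irreducible polynomials by orthogonality -/

open Classical in
/-- The average over `a` forces the first coefficient to vanish, and then `p₃` is the third
coefficient, which the average over `b` forces to be `c`. -/
theorem sum_weight_mul (hχ : χ ≠ 1) (c : F) (f : F[X]) :
    ∑ b, χ (b * c) * ∑ a, weight χ a b f =
      if topCoeff f 1 = 0 ∧ topCoeff f 3 = c then (Fintype.card F : ℤ) ^ 2 else 0 := by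
  have h1 (b : F) : ∑ a, weight χ a b f =
      χ (b * cubeSum f) * if topCoeff f 1 = 0 then (Fintype.card F : ℤ) else 0 := by
    simp_rw [weight, AddChar.map_add_eq_mul, ← mul_sum,
      AddChar.sum_mulShift (topCoeff f 1) (AddChar.IsPrimitive.of_ne_one hχ)]
    split_ifs <;> simp
  simp_rw [h1, ← mul_assoc, ← sum_mul, ← AddChar.map_add_eq_mul, ← mul_add,
    AddChar.sum_mulShift (c + cubeSum f) (AddChar.IsPrimitive.of_ne_one hχ), CharTwo.add_eq_zero]
  by_cases h : topCoeff f 1 = 0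
  · have h3 : cubeSum f = topCoeff f 3 := by simp [cubeSum, h]
    rw [h3, eq_comm (a := c)]
    simp only [h, if_true, true_and]
    split_ifs <;> simp [sq]
  · simp [h]

/-- The divisors `d` of `m` with `m / d` even are the divisors of `m / 2`, so this counts the
elements of the field with `q ^ (m / 2)` elements by their minimal polynomials. -/
theorem sum_even_divisors_card_irreds {m : ℕ} (hm : 0 < m) :
    ∑ d ∈ m.divisors with Even (m / d), (d : ℤ) * #(irreds F d) =
      if Even m then (Fintype.card F : ℤ) ^ (m / 2) else 0 := by
  split_ifs with h
  · obtain ⟨k, rfl⟩ := h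
    have hk : 0 < k := by omega
    have hd : (k + k).divisors.filter (fun d => Even ((k + k) / d)) = k.divisors := by
      ext d
      simp only [mem_filter, Nat.mem_divisors]
      constructor
      · rintro ⟨⟨⟨e, he⟩, -⟩, heven⟩
        have hd : 0 < d := Nat.pos_of_ne_zero (by rintro rfl; omega)
        rw [he, Nat.mul_div_cancel_left _ hd] at heven
        obtain ⟨e', rfl⟩ := heven
        exact ⟨⟨e', by rw [mul_add] at he; omega⟩, hk.ne'⟩
      · rintro ⟨⟨e, rfl⟩, -⟩
        have hd : 0 < d := Nat.pos_of_mul_pos_right hk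
        rw [← mul_add, Nat.mul_div_cancel_left _ hd]
        exact ⟨⟨dvd_mul_right _ _, by rw [mul_add]; omega⟩, ⟨e, rfl⟩⟩
    rw [hd, show (k + k) / 2 = k by omega,
      ← primeSum_weight_zero_zero (1 : AddChar F ℤ) hk, primeSum]
    refine sum_congr rfl fun d _ => ?_
    simp [weight, mul_comm]
  · rw [filter_false_of_mem, sum_empty]
    intro d hd he
    obtain ⟨e, rfl⟩ := Nat.dvd_of_mem_divisors hd
    have hd : 0 < d := Nat.pos_of_mul_pos_right hm
    rw [Nat.mul_div_cancel_left _ hd] at he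
    exact h (he.mul_left d)

open Classical in
/-- Multiply the sums `∑ a, primeSum (weight χ a b) m` by `χ (b c)` and sum over `b`.  On the left,
orthogonality selects the prescribed coefficients; on the right, `b = 0` contributes `q ^ m`. -/
theorem sum_odd_divisors_numIrreducible (hχ : χ ≠ 1) (hF : ∀ x, χ (x ^ 2) = χ x) (c : F) {m : ℕ}
    (hm : 0 < m) :
    (Fintype.card F : ℤ) ^ 2 * (∑ d ∈ m.divisors with Odd (m / d), (d : ℤ) * numIrreducible c d +
        if c = 0 ∧ Even m then (Fintype.card F : ℤ) ^ (m / 2) else 0) =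
      (Fintype.card F : ℤ) ^ m + (Fintype.card F : ℤ) ^ (m / 2 + 1) *
        ∑ b ∈ univ.erase 0, χ (b * c) * normalizedSum (radicalCard b) m := by
  have hχ' := AddChar.IsPrimitive.of_ne_one hχ
  have hleft : ∑ b, χ (b * c) * ∑ a, primeSum (weight χ a b) m =
      (Fintype.card F : ℤ) ^ m + (Fintype.card F : ℤ) ^ (m / 2 + 1) *
        ∑ b ∈ univ.erase 0, χ (b * c) * normalizedSum (radicalCard b) m := by
    rw [← add_sum_erase _ _ (mem_univ (0 : F)), mul_sum (univ.erase 0)]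
    congr 1
    · rw [sum_eq_single 0 (fun a _ ha => primeSum_weight_zero_right hχ ha hm) (by simp),
        primeSum_weight_zero_zero χ hm]
      simp
    · refine sum_congr rfl fun b hb => ?_
      rw [sum_primeSum_weight hχ hF (ne_of_mem_erase hb) hm]
      ring
  rw [← hleft]
  have hswap : ∑ b, χ (b * c) * ∑ a, primeSum (weight χ a b) m =
      ∑ d ∈ m.divisors, ∑ P ∈ irreds F d,
        d * ∑ b, χ (b * c) * ∑ a, weight χ a b P ^ (m / d) := by
    simp_rw [primeSum, mul_sum]
    rw [sum_congr rfl fun b _ => sum_comm, sum_comm]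
    refine sum_congr rfl fun d _ => ?_
    rw [sum_congr rfl fun b _ => sum_comm, sum_comm]
    refine sum_congr rfl fun P _ => sum_congr rfl fun b _ => sum_congr rfl fun a _ => ?_
    ring
  rw [hswap, ← sum_filter_add_sum_filter_not m.divisors (fun d => Odd (m / d)), mul_add]
  congr 1
  · rw [mul_sum]
    refine sum_congr rfl fun d hd => ?_
    have hodd : ¬ Even (m / d) := Nat.not_even_iff_odd.2 (mem_filter.1 hd).2
    simp_rw [weight_pow, if_neg hodd, sum_weight_mul hχ, numIrreducible_eq_card]
    rw [← mul_sum, ← sum_filter, sum_const, nsmul_eq_mul]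
    ring
  · simp_rw [Nat.not_odd_iff_even]
    have hc : ∑ b, χ (b * c) * ∑ _a : F, (1 : ℤ) =
        if c = 0 then (Fintype.card F : ℤ) ^ 2 else 0 := by
      rw [← sum_mul, AddChar.sum_mulShift c hχ']
      split_ifs <;> simp [sq]
    have heq : ∑ d ∈ m.divisors with Even (m / d), ∑ P ∈ irreds F d,
        (d : ℤ) * ∑ b, χ (b * c) * ∑ a, weight χ a b P ^ (m / d) =
        (∑ d ∈ m.divisors with Even (m / d), (d : ℤ) * #(irreds F d)) *
          if c = 0 then (Fintype.card F : ℤ) ^ 2 else 0 := by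
      rw [sum_mul]
      refine sum_congr rfl fun d hd => ?_
      simp_rw [weight_pow, if_pos (mem_filter.1 hd).2, hc]
      rw [sum_const, nsmul_eq_mul]
      ring
    rw [heq, sum_even_divisors_card_irreds hm]
    by_cases h1 : c = 0 <;> by_cases h2 : Even m <;> simp [h1, h2, mul_comm]

end

/-! ### Cubes and the sign of the cubic sum -/

section

variable {F : Type*} [Field F]

theorem exists_mem_zpowers_iff {γ : Fˣ} (hγ : Subgroup.zpowers γ = ⊤) {c : F} (hc : c ≠ 0) :
    (∃ u ∈ Subgroup.zpowers (γ ^ 3), (u : F) = c) ↔ ∃ w : F, w ^ 3 = c := by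
  constructor
  · rintro ⟨u, ⟨k, rfl⟩, rfl⟩
    refine ⟨((γ ^ k : Fˣ) : F), ?_⟩
    rw [← Units.val_pow_eq_pow_val]
    congr 1
    change (γ ^ k) ^ 3 = (γ ^ 3) ^ k
    rw [← zpow_natCast, ← zpow_natCast, zpow_comm]
  · rintro ⟨w, rfl⟩
    have hw : w ≠ 0 := by rintro rfl; simp at hc
    have : Units.mk0 w hw ∈ Subgroup.zpowers γ := hγ ▸ Subgroup.mem_top _
    obtain ⟨k, hk⟩ := this
    refine ⟨(γ ^ 3) ^ k, ⟨k, rfl⟩, ?_⟩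
    have h : (γ ^ 3) ^ k = Units.mk0 w hw ^ 3 := by
      rw [← hk]
      change _ = (γ ^ k) ^ 3
      rw [← zpow_natCast, ← zpow_natCast, zpow_comm]
    rw [h]
    simp

variable [Fintype F]

open Classical in
theorem card_cube_eq_of_dvd (h3 : 3 ∣ Fintype.card F - 1) {b : F} (hb : b ≠ 0) :
    #{w : F | w ^ 3 = b} = if ∃ w : F, w ^ 3 = b then 3 else 0 := by
  split_ifs with h
  · obtain ⟨w₀, rfl⟩ := h
    have hw₀ : w₀ ≠ 0 := by rintro rfl; simp at hb
    have : Fact (Nat.Prime 3) := ⟨Nat.prime_three⟩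
    rw [← Fintype.card_units] at h3
    obtain ⟨ζ, hζ⟩ := exists_prime_orderOf_dvd_card 3 h3
    have hprim : IsPrimitiveRoot (ζ : F) 3 :=
      IsPrimitiveRoot.coe_units_iff.2 (hζ ▸ IsPrimitiveRoot.orderOf ζ)
    refine Eq.trans (Eq.symm ?_) hprim.card_nthRootsFinset
    refine card_bij (fun u _ => u * w₀) ?_ ?_ ?_
    · intro u hu
      rw [mem_nthRootsFinset three_pos] at hu
      simp [mul_pow, hu]
    · intro u _ v _ huv
      exact mul_right_cancel₀ hw₀ huv
    · intro w hw
      simp only [mem_filter, mem_univ, true_and] at hw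
      refine ⟨w / w₀, ?_, div_mul_cancel₀ _ hw₀⟩
      rw [mem_nthRootsFinset three_pos, div_pow, hw, div_self hb]
  · rw [card_eq_zero, filter_eq_empty_iff]
    exact fun w _ hw => h ⟨w, hw⟩

open Classical in
theorem card_cube_eq_of_coprime (h3 : Nat.Coprime (Fintype.card F - 1) 3) {b : F} (hb : b ≠ 0) :
    #{w : F | w ^ 3 = b} = 1 := by
  rw [← Fintype.card_units, ← Nat.card_eq_fintype_card] at h3
  rw [card_eq_one]
  refine ⟨((powCoprime h3).symm (Units.mk0 b hb) : Fˣ), ?_⟩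
  ext w
  simp only [mem_filter, mem_univ, true_and, mem_singleton]
  have h : ((powCoprime h3).symm (Units.mk0 b hb)) ^ 3 = Units.mk0 b hb :=
    (powCoprime h3).apply_symm_apply _
  constructor
  · intro hw
    have hw0 : w ≠ 0 := by rintro rfl; exact hb (by simpa using hw.symm)
    have : Units.mk0 b hb = powCoprime h3 (Units.mk0 w hw0) := by
      ext; simpa using hw.symm
    rw [this, Equiv.symm_apply_apply, Units.val_mk0]
  · rintro rfl
    simpa using congrArg Units.val h

open Classical in
theorem card_mul_cube_eq_one {b : F} (hb : b ≠ 0) :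
    #{w : F | b * w ^ 3 = 1} = #{w : F | w ^ 3 = b} := by
  refine card_nbij' (fun w => w⁻¹) (fun w => w⁻¹) ?_ ?_ (by simp [Set.LeftInvOn])
    (by simp [Set.LeftInvOn])
  · intro w hw
    simp only [coe_filter, mem_univ, true_and, Set.mem_ofPred_eq] at hw ⊢
    rw [inv_pow, eq_inv_of_mul_eq_one_left hw]
  · intro w hw
    simp only [coe_filter, mem_univ, true_and, Set.mem_ofPred_eq] at hw ⊢
    rw [inv_pow, hw, mul_inv_cancel₀ hb]

variable {χ : AddChar F ℤ}

open Classical in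
theorem sum_erase_zero (hχ : χ ≠ 1) (c : F) :
    ∑ b ∈ univ.erase 0, χ (b * c) = (if c = 0 then (Fintype.card F : ℤ) else 0) - 1 := by
  have h := add_sum_erase univ (fun b => χ (b * c)) (mem_univ 0)
  rw [AddChar.sum_mulShift c (AddChar.IsPrimitive.of_ne_one hχ)] at h
  rw [zero_mul, AddChar.map_zero_eq_one] at h
  split_ifs at h ⊢ <;> push_cast at h <;> linear_combination h

open Classical in
theorem sum_erase_zero_mul_card_cube (χ : AddChar F ℤ) (c : F) :
    ∑ b ∈ univ.erase 0, χ (b * c) * #{w : F | w ^ 3 = b} = cubicSum χ 0 c - 1 := by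
  have h := add_sum_erase univ (fun b => χ (b * c) * (#{w : F | w ^ 3 = b} : ℤ)) (mem_univ 0)
  have h1 : ∑ b, χ (b * c) * (#{w : F | w ^ 3 = b} : ℤ) = cubicSum χ 0 c := by
    rw [cubicSum, ← sum_fiberwise univ (fun w : F => w ^ 3)
      (fun w => χ (c * w ^ 3 + 0 * w))]
    refine sum_congr rfl fun b _ => ?_
    rw [mul_comm (χ _), ← nsmul_eq_mul, ← sum_const]
    refine sum_congr rfl fun w hw => ?_
    rw [(mem_filter.1 hw).2]
    ring_nf
  rw [h1] at h
  have h0 : #{w : F | w ^ 3 = 0} = 1 := by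
    rw [card_eq_one]
    exact ⟨0, by ext w; simp⟩
  rw [h0, zero_mul, AddChar.map_zero_eq_one] at h
  linear_combination h

theorem three_dvd_cubicSum_zero_left_sub_one (h3 : 3 ∣ Fintype.card F - 1)
    (χ : AddChar F ℤ) (c : F) :
    (3 : ℤ) ∣ cubicSum χ 0 c - 1 := by
  classical
  rw [← sum_erase_zero_mul_card_cube]
  refine dvd_sum fun b hb => Dvd.dvd.mul_left ?_ _
  rw [card_cube_eq_of_dvd h3 (ne_of_mem_erase hb)]
  split_ifs <;> simp

variable [CharP F 2]

open Classical in
theorem radicalCard_eq_card_cube {b : F} (hb : b ≠ 0) :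
    radicalCard b = #{w : F | w ^ 3 = b} + 1 := by
  rw [radicalCard_eq hb, card_mul_cube_eq_one hb]

open Classical in
theorem sum_normalizedSum_of_coprime (h3 : Nat.Coprime (Fintype.card F - 1) 3) (hχ : χ ≠ 1)
    (c : F) (m : ℕ) :
    ∑ b ∈ univ.erase 0, χ (b * c) * normalizedSum (radicalCard b) m =
      ((if c = 0 then (Fintype.card F : ℤ) else 0) - 1) * normalizedSum 2 m := by
  rw [← sum_erase_zero hχ, sum_mul]
  refine sum_congr rfl fun b hb => ?_
  rw [radicalCard_eq_card_cube (ne_of_mem_erase hb),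
    card_cube_eq_of_coprime h3 (ne_of_mem_erase hb)]
  rfl

open Classical in
/-- When `q ≡ 1` modulo `3`, the order of the radical is `4` or `1` according as the number of cube
roots of `b` is `3` or `0`, so the normalized sum is affine in that number. -/
theorem sum_normalizedSum_of_dvd (h3 : 3 ∣ Fintype.card F - 1) (hχ : χ ≠ 1) (c : F) (m : ℕ) :
    3 * ∑ b ∈ univ.erase 0, χ (b * c) * normalizedSum (radicalCard b) m =
      3 * ((if c = 0 then (Fintype.card F : ℤ) else 0) - 1) * normalizedSum 1 m +
        (cubicSum χ 0 c - 1) * (normalizedSum 4 m - normalizedSum 1 m) := by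
  rw [← sum_erase_zero hχ, ← sum_erase_zero_mul_card_cube, mul_sum, mul_sum, sum_mul, sum_mul,
    ← sum_add_distrib]
  refine sum_congr rfl fun b hb => ?_
  rw [radicalCard_eq_card_cube (ne_of_mem_erase hb), card_cube_eq_of_dvd h3 (ne_of_mem_erase hb)]
  split_ifs <;> push_cast <;> norm_num <;> ring

open Classical in
/-- Up to sign `∑ z, χ (c z ^ 3)` is `2 √q` or `√q`, and the sign is fixed by its residue
modulo `3`. -/
theorem cubicSum_zero_left (hχ : χ ≠ 1) (hF : ∀ x, χ (x ^ 2) = χ x) {k : ℕ}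
    (hk : Fintype.card F = 2 ^ (2 * k)) {c : F} (hc : c ≠ 0) :
    cubicSum χ 0 c =
      if ∃ w : F, w ^ 3 = c then -2 * (-1) ^ k * 2 ^ k else (-1) ^ k * 2 ^ k := by
  have h4 : 2 ^ (2 * k) % 3 = 1 := by rw [pow_mul, Nat.pow_mod]; simp
  have h3 : 3 ∣ Fintype.card F - 1 := by rw [hk]; omega
  have hdvd := three_dvd_cubicSum_zero_left_sub_one h3 χ c
  have hcube := cubicSum_cube hχ hF 0 c
  rw [radicalCard_eq_card_cube hc, card_cube_eq_of_dvd h3 hc, hk] at hcube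
  set S := cubicSum χ 0 c
  have hS : S ≠ 0 := by
    intro h
    rw [h] at hdvd
    omega
  have hs3 : ((-1) ^ k * 2 ^ k : ℤ) % 3 = 1 := by
    have h : (-1 * 2 : ℤ) ^ k ≡ 1 ^ k [ZMOD 3] := Int.ModEq.pow k (by decide)
    rw [one_pow] at h
    rw [← mul_pow]
    exact h
  set s : ℤ := (-1) ^ k * 2 ^ k with hs
  have hsq : s ^ 2 = 2 ^ (2 * k) := by
    rw [hs, mul_pow, ← pow_mul, ← pow_mul, mul_comm k 2, pow_mul (-1)]
    simp
  push_cast at hcube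
  rw [← hsq] at hcube
  split_ifs at hcube ⊢
  · have h : (S - 2 * s) * (S + 2 * s) = 0 := by
      apply mul_left_cancel₀ hS
      norm_num at hcube
      linear_combination hcube
    rcases mul_eq_zero.1 h with h | h
    · omega
    · rw [mul_assoc, ← hs]
      omega
  · have h : (S - s) * (S + s) = 0 := by
      apply mul_left_cancel₀ hS
      norm_num at hcube
      linear_combination hcube
    rcases mul_eq_zero.1 h with h | h
    · omega
    · omega

end

/-! ### Elements of degree `m` and their minimal polynomials -/

section

variable {F K : Type*} [Field F] [Field K] [Algebra F K]

theorem forall_notMem_iff_natDegree_minpoly [FiniteDimensional F K] (z : K) :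
    (∀ L : IntermediateField F K, Module.finrank F L < Module.finrank F K → z ∉ L) ↔
      (minpoly F z).natDegree = Module.finrank F K := by
  have hz : IsIntegral F z := IsIntegral.of_finite F z
  have hdeg := IntermediateField.adjoin.finrank hz
  constructor
  · intro h
    refine le_antisymm (minpoly.natDegree_le z) (not_lt.1 fun hlt => ?_)
    exact h _ (hdeg ▸ hlt) (IntermediateField.mem_adjoin_simple_self F z)
  · intro h L hL hzL
    have hle : Module.finrank F (IntermediateField.adjoin F {z}) ≤ Module.finrank F L :=
      Submodule.finrank_mono (s := (IntermediateField.adjoin F {z}).toSubmodule)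
        (t := L.toSubmodule) (IntermediateField.adjoin_simple_le_iff.2 hzL)
    omega

theorem topCoeff_map (f : F[X]) (k : ℕ) :
    topCoeff (f.map (algebraMap F K)) k = algebraMap F K (topCoeff f k) := by
  simp only [topCoeff, natDegree_map, coeff_map]
  split_ifs <;> simp

theorem cubeSum_map (f : F[X]) :
    cubeSum (f.map (algebraMap F K)) = algebraMap F K (cubeSum f) := by
  simp [cubeSum, topCoeff_map]

theorem topCoeff_one_prod_X_sub_C [CharP F 2] (s : Multiset F) :
    topCoeff (s.map fun r => X - C r).prod 1 = s.sum := by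
  induction s using Multiset.induction_on with
  | empty => simp [topCoeff_one]
  | cons r s ih =>
    rw [Multiset.map_cons, Multiset.prod_cons, topCoeff_one_mul (monic_X_sub_C r)
      (monic_multiset_prod_of_monic _ _ fun r _ => monic_X_sub_C r), ih, Multiset.sum_cons,
      CharTwo.sub_eq_add, topCoeff_X_add_C]
    simp

theorem cubeSum_prod_X_sub_C [CharP F 2] (s : Multiset F) :
    cubeSum (s.map fun r => X - C r).prod = (s.map (· ^ 3)).sum := by
  induction s using Multiset.induction_on with
  | empty => simp [topCoeff_one, cubeSum]
  | cons r s ih =>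
    rw [Multiset.map_cons, Multiset.prod_cons, cubeSum_mul (monic_X_sub_C r)
      (monic_multiset_prod_of_monic _ _ fun r _ => monic_X_sub_C r), ih, Multiset.map_cons,
      Multiset.sum_cons, CharTwo.sub_eq_add, cubeSum_X_add_C]

variable [Finite F] [FiniteDimensional F K]

/-- The conjugates of an element of full degree are the roots of its minimal polynomial. -/
theorem minpoly_map_eq_prod_automorphisms {z : K}
    (hz : (minpoly F z).natDegree = Module.finrank F K) :
    (minpoly F z).map (algebraMap F K) =
      ((univ : Finset (K ≃ₐ[F] K)).val.map fun σ => X - C (σ z)).prod := by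
  have : Finite K := Module.finite_of_finite F
  have hint : IsIntegral F z := IsIntegral.of_finite F z
  have htop : IntermediateField.adjoin F {z} = ⊤ :=
    IntermediateField.eq_of_le_of_finrank_eq le_top (by
      rw [IntermediateField.adjoin.finrank hint, hz, IntermediateField.finrank_top'])
  have hinj : Function.Injective fun σ : K ≃ₐ[F] K => σ z := by
    intro σ τ h
    ext x
    have hx : x ∈ IntermediateField.adjoin F {z} := htop ▸ IntermediateField.mem_top
    induction hx using IntermediateField.adjoin_induction with
    | mem x hx => rwa [Set.mem_singleton_iff.1 hx]
    | algebraMap x => simp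
    | add x y _ _ hx hy => rw [map_add, map_add, hx, hy]
    | inv x _ hx => rw [map_inv₀, map_inv₀, hx]
    | mul x y _ _ hx hy => rw [map_mul, map_mul, hx, hy]
  refine eq_of_monic_of_dvd_of_natDegree_le
    (monic_multiset_prod_of_monic _ _ fun σ _ => monic_X_sub_C (σ z))
    ((minpoly.monic hint).map _) ?_ ?_
  · refine Finset.prod_dvd_of_coprime ?_ ?_
    · intro σ _ τ _ hne
      exact isCoprime_X_sub_C_of_isUnit_sub (sub_ne_zero.2 fun h => hne (hinj h)).isUnit
    · intro σ _
      rw [dvd_iff_isRoot, IsRoot, eval_map_algebraMap]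
      simpa using minpoly.aeval_algHom F (σ : K →ₐ[F] K) z
  · rw [natDegree_multiset_prod_of_monic _ (by
      intro f hf
      obtain ⟨σ, -, rfl⟩ := Multiset.mem_map.1 hf
      exact monic_X_sub_C _), natDegree_map, hz, ← IsGalois.card_aut_eq_finrank]
    simp

theorem trace_eq_topCoeff_minpoly [CharP F 2] {z : K}
    (hz : (minpoly F z).natDegree = Module.finrank F K) :
    Algebra.trace F K z = topCoeff (minpoly F z) 1 ∧
      Algebra.trace F K (z ^ 3) = cubeSum (minpoly F z) := by
  have : Finite K := Module.finite_of_finite F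
  have : CharP K 2 := charP_of_injective_algebraMap (algebraMap F K).injective 2
  have h := minpoly_map_eq_prod_automorphisms hz
  have h' : ((univ : Finset (K ≃ₐ[F] K)).val.map fun σ => X - C (σ z)) =
      (((univ : Finset (K ≃ₐ[F] K)).val.map fun σ => σ z).map fun r => X - C r) := by
    rw [Multiset.map_map]
    rfl
  rw [h'] at h
  constructor
  · apply (algebraMap F K).injective
    rw [← topCoeff_map, h, topCoeff_one_prod_X_sub_C, trace_eq_sum_automorphisms]
    rfl
  · apply (algebraMap F K).injective
    rw [← cubeSum_map, h, cubeSum_prod_X_sub_C, trace_eq_sum_automorphisms, Multiset.map_map]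
    simp_rw [map_pow]
    rfl

open Classical in
/-- An irreducible polynomial of degree `[K : F]` is the minimal polynomial of as many elements
of `K`, since it divides `X ^ |K| - X`. -/
theorem card_minpoly_eq [Fintype K] {P : F[X]} (hP : P ∈ irreds F (Module.finrank F K)) :
    #{z : K | minpoly F z = P} = Module.finrank F K := by
  obtain ⟨⟨hmonic, hdeg⟩, hirr⟩ := mem_irreds.1 hP
  have hdvd : P ∣ X ^ Nat.card F ^ Module.finrank F K - X :=
    hirr.natDegree_dvd_iff_dvd_X_pow_card_pow_sub_X.1 hdeg.dvd
  have hcard : Nat.card F ^ Module.finrank F K = Fintype.card K := by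
    rw [← Nat.card_eq_fintype_card]
    exact (Module.natCard_eq_pow_finrank (K := F) (V := K)).symm
  have hne : (X ^ Fintype.card K - X : K[X]) ≠ 0 :=
    FiniteField.X_pow_card_sub_X_ne_zero K Fintype.one_lt_card
  have hroots := FiniteField.roots_X_pow_card_sub_X K
  have hsplits : (X ^ Fintype.card K - X : K[X]).Splits := by
    rw [splits_iff_card_roots, hroots, FiniteField.X_pow_card_sub_X_natDegree_eq K
      Fintype.one_lt_card]
    rfl
  have hdvd' : P.map (algebraMap F K) ∣ X ^ Fintype.card K - X := by
    rw [← hcard]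
    simpa using Polynomial.map_dvd (algebraMap F K) hdvd
  have hs := hsplits.of_dvd hne hdvd'
  have hnodup : (P.map (algebraMap F K)).roots.Nodup :=
    Multiset.nodup_of_le (roots.le_of_dvd hne hdvd') (hroots ▸ univ.nodup)
  have heq : ({z : K | minpoly F z = P} : Finset K) =
      (P.map (algebraMap F K)).roots.toFinset := by
    ext z
    simp only [mem_filter, mem_univ, true_and, Multiset.mem_toFinset,
      mem_roots (hmonic.map (algebraMap F K)).ne_zero, IsRoot, eval_map_algebraMap]
    constructor
    · rintro rfl
      exact minpoly.aeval F z
    · intro h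
      exact (minpoly.eq_of_irreducible_of_monic hirr h hmonic).symm
  rw [heq, Multiset.toFinset_card_of_nodup hnodup, ← hs.natDegree_eq_card_roots, natDegree_map,
    hdeg]

theorem countG_eq_mul_numIrreducible [CharP F 2] (c : F) :
    countG F K c 3 = Module.finrank F K * numIrreducible c (Module.finrank F K) := by
  classical
  have : Finite K := Module.finite_of_finite F
  let _ := Fintype.ofFinite K
  set T := (irreds F (Module.finrank F K)).filter
    (fun f => topCoeff f 1 = 0 ∧ topCoeff f 3 = c) with hT
  have hset : {z : K | Algebra.trace F K z = 0 ∧ Algebra.trace F K (z ^ 3) = c ∧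
      ∀ L : IntermediateField F K, Module.finrank F L < Module.finrank F K → z ∉ L} =
      (({z : K | minpoly F z ∈ T} : Finset K) : Set K) := by
    ext z
    simp only [forall_notMem_iff_natDegree_minpoly, Set.mem_ofPred_eq, coe_filter, mem_univ,
      true_and, hT, mem_filter, mem_irreds]
    have hint : IsIntegral F z := IsIntegral.of_finite F z
    constructor
    · rintro ⟨h1, h2, h3⟩
      obtain ⟨t1, t3⟩ := trace_eq_topCoeff_minpoly h3
      rw [t1] at h1
      rw [t3] at h2
      simp [cubeSum, h1] at h2
      exact ⟨⟨⟨minpoly.monic hint, h3⟩, minpoly.irreducible hint⟩, h1, h2⟩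
    · rintro ⟨⟨⟨-, h3⟩, -⟩, h1, h2⟩
      obtain ⟨t1, t3⟩ := trace_eq_topCoeff_minpoly h3
      rw [t1, t3]
      simp [cubeSum, h1, h2, h3]
  rw [countG, hset, Set.ncard_coe_finset, numIrreducible_eq_card, ← hT,
    card_eq_sum_card_fiberwise (f := fun z => minpoly F z) (t := T)
      (fun z hz => by simpa using hz)]
  rw [sum_congr rfl (g := fun _ => Module.finrank F K), sum_const, smul_eq_mul, mul_comm]
  intro P hP
  rw [← card_minpoly_eq (K := K) (mem_filter.1 hP).1, filter_filter]
  congr 1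
  ext z
  simp only [mem_filter, mem_univ, true_and, and_iff_right_iff_imp]
  rintro rfl
  exact hP

end

/-! ### The tables satisfy the divisor-sum identities -/

theorem normalizedSum_one {m : ℕ} (hm : m ≤ 30) :
    normalizedSum 1 m = if 3 ∣ m then -2 else 1 := by
  decide +revert

theorem normalizedSum_two {m : ℕ} (hm : m ≤ 30) :
    normalizedSum 2 m = [-2, 1, 1, -1, 0, -1, 1, 1].getD (m % 8) 0 := by
  decide +revert

theorem normalizedSum_four {m : ℕ} (hm : m ≤ 30) :
    normalizedSum 4 m = if 4 ∣ m then -2 else 1 := by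
  decide +revert

theorem tableOddZero_sum (q : ℝ) {m : ℕ} (hm : 0 < m) (hm' : m ≤ 30) :
    q ^ 2 * (∑ d ∈ m.divisors with Odd (m / d), tableOddZero q d +
        if Even m then q ^ (m / 2) else 0) =
      q ^ m + q ^ (m / 2 + 1) * ((q - 1) * normalizedSum 2 m) := by
  rw [normalizedSum_two hm', sum_filter]
  interval_cases m <;> simp [Nat.divisors_ofNat, Nat.odd_iff, Nat.even_iff] <;>
    simp only [tableOddZero] <;> ring1

theorem tableOddNonzero_sum (q : ℝ) {m : ℕ} (hm : 0 < m) (hm' : m ≤ 30) :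
    q ^ 2 * ∑ d ∈ m.divisors with Odd (m / d), tableOddNonzero q d =
      q ^ m + q ^ (m / 2 + 1) * -normalizedSum 2 m := by
  rw [normalizedSum_two hm', sum_filter]
  interval_cases m <;> simp [Nat.divisors_ofNat, Nat.odd_iff, -mul_eq_mul_left_iff,
    -mul_eq_zero] <;>
    simp only [tableOddNonzero] <;> ring1

theorem tableEvenZero_sum (q : ℝ) {m : ℕ} (hm : 0 < m) (hm' : m ≤ 30) :
    3 * (q ^ 2 * (∑ d ∈ m.divisors with Odd (m / d), tableEvenZero q d +
        if Even m then q ^ (m / 2) else 0)) =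
      3 * q ^ m + q ^ (m / 2 + 1) *
        (3 * (q - 1) * normalizedSum 1 m + (q - 1) * (normalizedSum 4 m - normalizedSum 1 m)) := by
  rw [normalizedSum_one hm', normalizedSum_four hm', sum_filter]
  interval_cases m <;> simp [Nat.divisors_ofNat, Nat.odd_iff, Nat.even_iff] <;>
    simp only [tableEvenZero] <;> ring1

theorem tableEvenCube_sum (s ε : ℝ) {m : ℕ} (hm : 0 < m) (hm' : m ≤ 30) :
    3 * ((s ^ 2) ^ 2 * ∑ d ∈ m.divisors with Odd (m / d), tableEvenCube (s ^ 2) s ε d) =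
      3 * (s ^ 2) ^ m + (s ^ 2) ^ (m / 2 + 1) * (-3 * normalizedSum 1 m +
        (-2 * ε * s - 1) * (normalizedSum 4 m - normalizedSum 1 m)) := by
  rw [normalizedSum_one hm', normalizedSum_four hm', sum_filter]
  interval_cases m <;> simp [Nat.divisors_ofNat, Nat.odd_iff] <;>
    simp only [tableEvenCube] <;> ring1

theorem tableEvenNoncube_sum (s ε : ℝ) {m : ℕ} (hm : 0 < m) (hm' : m ≤ 30) :
    3 * ((s ^ 2) ^ 2 * ∑ d ∈ m.divisors with Odd (m / d), tableEvenNoncube (s ^ 2) s ε d) =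
      3 * (s ^ 2) ^ m + (s ^ 2) ^ (m / 2 + 1) * (-3 * normalizedSum 1 m +
        (ε * s - 1) * (normalizedSum 4 m - normalizedSum 1 m)) := by
  rw [normalizedSum_one hm', normalizedSum_four hm', sum_filter]
  interval_cases m <;> simp [Nat.divisors_ofNat, Nat.odd_iff] <;>
    simp only [tableEvenNoncube] <;> ring1

/-- A function is determined by its sums over the divisors of odd codivisor. -/
theorem eq_of_sum_odd_divisors_eq {G T : ℕ → ℝ} {N : ℕ}
    (h : ∀ m, 0 < m → m ≤ N → ∑ d ∈ m.divisors with Odd (m / d), G d =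
      ∑ d ∈ m.divisors with Odd (m / d), T d) {m : ℕ} (hm : 0 < m) (hmN : m ≤ N) :
    G m = T m := by
  induction m using Nat.strong_induction_on with
  | _ m ih =>
    have hmem : m ∈ m.divisors.filter fun d => Odd (m / d) := by
      simp [hm.ne', Nat.div_self hm]
    have hsum := h m hm hmN
    rw [← add_sum_erase _ _ hmem, ← add_sum_erase _ _ hmem] at hsum
    have hrest : ∑ d ∈ (m.divisors.filter fun d => Odd (m / d)).erase m, G d =
        ∑ d ∈ (m.divisors.filter fun d => Odd (m / d)).erase m, T d := by
      refine sum_congr rfl fun d hd => ?_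
      rw [mem_erase, mem_filter, Nat.mem_divisors] at hd
      have hlt : d < m := lt_of_le_of_ne (Nat.le_of_dvd hm hd.2.1.1) hd.1
      exact ih d hlt (Nat.pos_of_dvd_of_pos hd.2.1.1 hm) (hlt.le.trans hmN)
    linarith

/-! ### Evaluation of the divisor sums of the number of irreducible polynomials -/

section

variable {F : Type*} [Field F] [Fintype F] [CharP F 2]

theorem sum_odd_divisors_of_coprime (h3 : Nat.Coprime (Fintype.card F - 1) 3)
    (c : F) {q : ℝ} (hq : q = Fintype.card F) {m : ℕ} (hm : 0 < m) [Decidable (c = 0)] :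
    q ^ 2 * (∑ d ∈ m.divisors with Odd (m / d), (d * numIrreducible c d : ℝ) +
        if c = 0 ∧ Even m then q ^ (m / 2) else 0) =
      q ^ m + q ^ (m / 2 + 1) * (((if c = 0 then q else 0) - 1) * normalizedSum 2 m) := by
  classical
  obtain ⟨χ, hχ, hF⟩ := exists_frobenius_invariant_addChar F
  have h := sum_odd_divisors_numIrreducible hχ hF c hm
  rw [sum_normalizedSum_of_coprime h3 hχ] at h
  rw [hq]
  have h' := congrArg (Int.cast : ℤ → ℝ) h
  push_cast at h'
  convert h' using 1

theorem sum_odd_divisors_of_even {k : ℕ} (hk : Fintype.card F = 2 ^ (2 * k)) (c : F)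
    {q : ℝ} (hq : q = Fintype.card F) {m : ℕ} (hm : 0 < m) [Decidable (c = 0)]
    [Decidable (∃ w : F, w ^ 3 = c)] :
    3 * (q ^ 2 * (∑ d ∈ m.divisors with Odd (m / d), (d * numIrreducible c d : ℝ) +
        if c = 0 ∧ Even m then q ^ (m / 2) else 0)) =
      3 * q ^ m + q ^ (m / 2 + 1) *
        (3 * ((if c = 0 then q else 0) - 1) * normalizedSum 1 m +
          ((if c = 0 then q else if ∃ w : F, w ^ 3 = c then -2 * (-1) ^ k * 2 ^ k
            else (-1) ^ k * 2 ^ k) - 1) * (normalizedSum 4 m - normalizedSum 1 m)) := by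
  classical
  obtain ⟨χ, hχ, hF⟩ := exists_frobenius_invariant_addChar F
  have h3 : 3 ∣ Fintype.card F - 1 := by
    have : 2 ^ (2 * k) % 3 = 1 := by rw [pow_mul, Nat.pow_mod]; simp
    rw [hk]
    omega
  have h := sum_odd_divisors_numIrreducible hχ hF c hm
  have hS : cubicSum χ 0 c = if c = 0 then (Fintype.card F : ℤ) else
      if ∃ w : F, w ^ 3 = c then -2 * (-1) ^ k * 2 ^ k else (-1) ^ k * 2 ^ k := by
    split_ifs with h0 h1
    · simp [h0, cubicSum]
    · rw [cubicSum_zero_left hχ hF hk h0, if_pos h1]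
    · rw [cubicSum_zero_left hχ hF hk h0, if_neg h1]
  have hb := sum_normalizedSum_of_dvd h3 hχ c m
  rw [hS] at hb
  rw [hq]
  have h' := congrArg (Int.cast : ℤ → ℝ) h
  have hb' := congrArg (Int.cast : ℤ → ℝ) hb
  push_cast at h' hb'
  have := congrArg (3 * ·) h'
  simp only [mul_add] at this ⊢
  rw [mul_left_comm 3 ((Fintype.card F : ℝ) ^ (m / 2 + 1)), hb'] at this
  convert this using 1
  ring

end

theorem mainTheorem1 {F K : Type*} [Field F] [Finite F] [Field K] [Algebra F K]
    (r m : ℕ) (hq : Nat.card F = 2 ^ r) (hm : 1 ≤ m) (hK : Module.finrank F K = m)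
    (c : F) (q : ℝ) (hqr : q = 2 ^ r) :
    (numIrreducible c m : ℚ) = (countG F K c 3 : ℚ) / (m : ℚ) ∧
    (m ≤ 30 →
      (Even r → c = 0 → (countG F K c 3 : ℝ) = tableEvenZero q m) ∧
      (Odd r → c = 0 → (countG F K c 3 : ℝ) = tableOddZero q m) ∧
      (Odd r → c ≠ 0 → (countG F K c 3 : ℝ) = tableOddNonzero q m) ∧
      (Even r → c ≠ 0 → ∀ γ : Fˣ, Subgroup.zpowers γ = ⊤ →
        ((∃ u ∈ Subgroup.zpowers (γ ^ 3), (u : F) = c) →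
          (countG F K c 3 : ℝ) = tableEvenCube q (Real.sqrt q) ((-1) ^ (r / 2)) m) ∧
        ((¬ ∃ u ∈ Subgroup.zpowers (γ ^ 3), (u : F) = c) →
          (countG F K c 3 : ℝ) = tableEvenNoncube q (Real.sqrt q) ((-1) ^ (r / 2)) m))) := by
  classical
  let _ := Fintype.ofFinite F
  have : Fact (Nat.Prime 2) := ⟨Nat.prime_two⟩
  have hcard : Fintype.card F = 2 ^ r := by rw [← hq, Nat.card_eq_fintype_card]
  have : CharP F 2 := charP_of_card_eq_prime_pow hcard
  have : FiniteDimensional F K := Module.finite_of_finrank_pos (by omega)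
  have hcount : countG F K c 3 = m * numIrreducible c m := hK ▸ countG_eq_mul_numIrreducible c
  have hqF : q = Fintype.card F := by rw [hqr, hcard]; push_cast; rfl
  have hq0 : q ^ 2 ≠ 0 := by rw [hqr]; positivity
  refine ⟨?_, fun hm30 => ?_⟩
  · rw [hcount, Nat.cast_mul, mul_div_cancel_left₀]
    exact_mod_cast (by omega : m ≠ 0)
  rw [hcount, Nat.cast_mul]
  have hodd (hr : Odd r) : Nat.Coprime (Fintype.card F - 1) 3 := by
    obtain ⟨k, rfl⟩ := hr
    have h2 : 2 ^ (2 * k + 1) % 3 = 2 := by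
      rw [pow_succ, pow_mul, Nat.mul_mod, Nat.pow_mod]; simp
    rw [hcard]
    generalize 2 ^ (2 * k + 1) = x at h2 ⊢
    refine ((Nat.Prime.coprime_iff_not_dvd Nat.prime_three).2 ?_).symm
    omega
  have hsqrt {k : ℕ} (hk : r = 2 * k) : q = (2 ^ k) ^ 2 ∧ Real.sqrt q = 2 ^ k := by
    have : q = (2 ^ k) ^ 2 := by rw [hqr, hk]; ring
    exact ⟨this, by rw [this, Real.sqrt_sq (by positivity)]⟩
  refine ⟨fun hr hc => ?_, fun hr hc => ?_, fun hr hc => ?_, fun hr hc γ hγ => ?_⟩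
  · obtain ⟨k, rfl⟩ := hr.exists_two_nsmul
    rw [smul_eq_mul] at hcard
    refine eq_of_sum_odd_divisors_eq (G := fun d => (d * numIrreducible c d : ℝ))
      (N := 30) (fun n hn hn' => ?_) hm hm30
    have h1 := sum_odd_divisors_of_even hcard c hqF hn
    have h2 := tableEvenZero_sum q hn hn'
    simp only [hc, true_and, if_true] at h1 ⊢
    exact add_right_cancel (mul_left_cancel₀ hq0 (mul_left_cancel₀ three_ne_zero
      (h1.trans h2.symm)))
  · refine eq_of_sum_odd_divisors_eq (G := fun d => (d * numIrreducible c d : ℝ))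
      (N := 30) (fun n hn hn' => ?_) hm hm30
    have h1 := sum_odd_divisors_of_coprime (hodd hr) c hqF hn
    have h2 := tableOddZero_sum q hn hn'
    simp only [hc, true_and, if_true] at h1 ⊢
    exact add_right_cancel (mul_left_cancel₀ hq0 (h1.trans h2.symm))
  · refine eq_of_sum_odd_divisors_eq (G := fun d => (d * numIrreducible c d : ℝ))
      (N := 30) (fun n hn hn' => ?_) hm hm30
    have h1 := sum_odd_divisors_of_coprime (hodd hr) c hqF hn
    have h2 := tableOddNonzero_sum q hn hn'
    simp only [hc, false_and, if_false, zero_sub, neg_mul, one_mul, add_zero] at h1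
    exact mul_left_cancel₀ hq0 (h1.trans h2.symm)
  · rw [exists_mem_zpowers_iff hγ hc]
    obtain ⟨k, rfl⟩ := hr.exists_two_nsmul
    rw [smul_eq_mul] at hcard
    obtain ⟨hqs, hs⟩ := hsqrt (smul_eq_mul 2 k)
    rw [hs, smul_eq_mul, Nat.mul_div_cancel_left k two_pos]
    refine ⟨fun hcube => ?_, fun hcube => ?_⟩ <;>
      refine eq_of_sum_odd_divisors_eq (G := fun d => (d * numIrreducible c d : ℝ))
        (N := 30) (fun n hn hn' => ?_) hm hm30 <;>
      have h1 := sum_odd_divisors_of_even hcard c hqF hn <;>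
      refine mul_left_cancel₀ hq0 (mul_left_cancel₀ three_ne_zero ?_)
    · simp only [hc, hcube, false_and, if_false, if_true, zero_sub, mul_neg, mul_one,
        add_zero] at h1
      rw [h1, hqs]
      exact (tableEvenCube_sum _ _ hn hn').symm
    · simp only [hc, hcube, false_and, if_false, zero_sub, mul_neg, mul_one, add_zero] at h1
      rw [h1, hqs]
      exact (tableEvenNoncube_sum _ _ hn hn').symm
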